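/- A Choquet simplex is a nonempty compact convex subset $S$ of a Hausdorff locally convex real topological vector space $E$ such that the cone $\{(ts,t): t\ge 0,\ s\in S\}\subset E\times\mathbb R$ generated by $S\times\{1\}$ is a lattice in its own order; $A(S)$ denotes the Banach space of real continuous affine functions on $S$ with the supremum norm. Let $X$ be a real Banach space whose dual $X^*$ is isometrically isomorphic to $\ell_1$; fix such an identification $X^*=\ell_1$ and let $\sigma(\ell_1,X)$ be the corresponding weak$^*$ topology on $\ell_1$. Then the following are equivalent: 1. $\ell_1$ lacks the $\sigma(\ell_1,X)$-fixed point property for nonexpansive mappings; that is, there are a nonempty, convex, $\sigma(\ell_1,X)$-compact set $C\subset\ell_1$ and a mapping $T:C\to C$ without a fixed point such that $\|T(x)-T(y)\|_1\le\|x-y\|_1$ for all $x,y\in C$. 2. There are a closed subspace $Y$ of $X$ and a Choquet simplex $S$ such that $A(S)$ is infinite-dimensional and the quotient $X/Y$ is linearly isometric to $A(S)$. 3. There are a closed subspace $Y$ of $X$ and a Choquet simplex $S$ such that $A(S)$ is infinite-dimensional and the quotient $X/Y$ contains a linearly isometric copy of $A(S)$. -/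

import Mathlib

universe u v

/-- The real Banach space `ℓ₁` of absolutely summable sequences with its usual norm. -/
abbrev EllOne : Type := lp (fun _ : ℕ => ℝ) 1

/-- The convex cone in `E × ℝ` generated by `S × {1}`. -/
def coneOver {E : Type*} [AddCommGroup E] [Module ℝ E] (S : Set E) : Set (E × ℝ) :=
  {p | ∃ t : ℝ, 0 ≤ t ∧ ∃ s ∈ S, p = (t • s, t)}

/-- A Choquet simplex in `E`: a nonempty compact convex set `S` such that the cone over `S` is a
lattice in its own order (`x ≤ y` when `y - x` lies in the cone), that is, any two of its elements
`x`, `y` have a least upper bound `z`. (The greatest lower bound of `x` and `y` is then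
`x + y - z`.) In the sequel `E` is always a Hausdorff locally convex space. -/
structure ChoquetSimplex (E : Type*) [AddCommGroup E] [Module ℝ E] [TopologicalSpace E] where
  carrier : Set E
  nonempty : carrier.Nonempty
  isCompact : IsCompact carrier
  convex : Convex ℝ carrier
  exists_sup : ∀ x ∈ coneOver carrier, ∀ y ∈ coneOver carrier, ∃ z ∈ coneOver carrier,
    z - x ∈ coneOver carrier ∧ z - y ∈ coneOver carrier ∧
      ∀ w ∈ coneOver carrier, w - x ∈ coneOver carrier → w - y ∈ coneOver carrier →
        w - z ∈ coneOver carrier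

instance ChoquetSimplex.instCompactSpace {E : Type*} [AddCommGroup E] [Module ℝ E]
    [TopologicalSpace E] (S : ChoquetSimplex E) : CompactSpace S.carrier :=
  isCompact_iff_compactSpace.mp S.isCompact

/-- The space `A(S)` of real continuous affine functions on `S`, as a subspace of `C(S, ℝ)`, from
which it inherits the supremum norm. -/
def affineFunctions {E : Type*} [AddCommGroup E] [Module ℝ E] [TopologicalSpace E]
    (S : ChoquetSimplex E) : Submodule ℝ C(S.carrier, ℝ) where
  carrier := {f | ∀ x y z : S.carrier, ∀ a b : ℝ, 0 ≤ a → 0 ≤ b → a + b = 1 →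
    (z : E) = a • (x : E) + b • (y : E) → f z = a * f x + b * f y}
  add_mem' := by
    intro f g hf hg x y z a b ha hb hab hz
    simp only [ContinuousMap.add_apply, hf x y z a b ha hb hab hz, hg x y z a b ha hb hab hz]
    ring
  zero_mem' := by
    intro x y z a b _ _ _ _
    simp
  smul_mem' := by
    intro c f hf x y z a b ha hb hab hz
    simp only [ContinuousMap.smul_apply, smul_eq_mul, hf x y z a b ha hb hab hz]
    ring

/-- The normed space `Z` has the fixed point property for nonexpansive mappings with respect to
the topology `τ`: every nonexpansive self-mapping of a nonempty, convex, `τ`-compact subset of `Z`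
has a fixed point. -/
def HasFPP (Z : Type*) [NormedAddCommGroup Z] [NormedSpace ℝ Z] (τ : TopologicalSpace Z) : Prop :=
  ∀ C : Set Z, C.Nonempty → Convex ℝ C → @IsCompact Z τ C →
    ∀ T : C → C, (∀ x y : C, ‖(T x : Z) - (T y : Z)‖ ≤ ‖(x : Z) - (y : Z)‖) →
      ∃ x : C, T x = x

/-- The weak-star topology `σ(Z, X)` on a space `Z` that is identified with the dual of `X`
through `Φ`. -/
@[reducible] noncomputable def sigmaTopology {X Z : Type*} [NormedAddCommGroup X] [NormedSpace ℝ X]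
    [NormedAddCommGroup Z] [NormedSpace ℝ Z] (Φ : StrongDual ℝ X ≃ₗᵢ[ℝ] Z) :
    TopologicalSpace Z :=
  TopologicalSpace.induced (fun z => StrongDual.toWeakDual (Φ.symm z))
    (inferInstance : TopologicalSpace (WeakDual ℝ X))

open Filter Topology TopologicalSpace

/-! ### Coordinates, basis and bounded linear maps on `ℓ₁`. -/

namespace EllOne

/-! Both non-trivial implications pass through the same two objects: a weak-star compact convex
subset `D` of the unit sphere of `ℓ₁` that is not norm compact, and a linear isometry `J` of `ℓ₁`
into itself with `J e_k → J α` weak-star for some `α` in the positive face of the sphere.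

From `D` to `J`: by convexity all elements of `D` share one sign pattern `ε`, so each is the
barycentre of a probability measure on the signed basis vectors. Along an ultrafilter on `D` with no
norm limit in `D`, coordinate mass is lost, and a limit measure on the weak-star ball charges the
cluster points of the signed basis. Its barycentre lies in `D`, so almost all its points have signed
sum one. This gives a subsequence `ε_n e_n` converging weak-star to a compatible `f` of norm one
(`exists_basis_subseq_tendsto`), and blocks with disjoint supports give `J`
(`exists_isometry_of_basis_subseq`).

If the fixed point property fails, the coordinatewise limit `y` of approximate fixed points lies
outside the domain, and the map preserves the set of points nearest to `y`. Translated and scaled,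
that set is `D` (`exists_noncompact_convex_of_not_hasFPP`). The image under `J` of the positive face
is then a weak-star compact simplex `S`; a Hahn–Banach separation shows that restriction from `X` to
`S` is a quotient map onto `A(S)` (`exists_approx_predual`,
`exists_quotient_isometric_affineFunctions`).

Conversely, if `A(S)` embeds in `X/Y`, evaluations at the infinitely many extreme points of `S` are
uniformly separated by the lattice property. Their norm-one extensions make the state face of `X/Y`
a suitable `D` (`exists_noncompact_convex_of_simplex`). The resulting `J` carries the right shift,
which has no fixed point on the positive face (`not_hasFPP_of_isometry`). -/

theorem summable_abs (g : EllOne) : Summable fun i => |g i| := by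
  simpa using (lp.memℓp g).summable (by norm_num)

theorem norm_eq (g : EllOne) : ‖g‖ = ∑' i, |g i| := by
  rw [lp.norm_eq_tsum_rpow (by norm_num)]
  simp

theorem summable (g : EllOne) : Summable fun i => g i := (summable_abs g).of_abs

/-- The element of `ℓ₁` with prescribed absolutely summable coordinates. -/
noncomputable def ofSummable (f : ℕ → ℝ) (hf : Summable fun i => |f i|) : EllOne :=
  ⟨f, memℓp_gen (by simpa using hf)⟩

@[simp] theorem ofSummable_apply (f : ℕ → ℝ) (hf : Summable fun i => |f i|) (i : ℕ) :
    ofSummable f hf i = f i := rfl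

theorem ext {f g : EllOne} (h : ∀ i, f i = g i) : f = g := lp.ext (funext h)

theorem abs_apply_le (g : EllOne) (i : ℕ) : |g i| ≤ ‖g‖ := by
  simpa using lp.norm_apply_le_norm (by norm_num) g i

theorem sum_abs_le (g : EllOne) (s : Finset ℕ) : ∑ i ∈ s, |g i| ≤ ‖g‖ := by
  rw [norm_eq]; exact (summable_abs g).sum_le_tsum s (fun i _ => abs_nonneg _)

theorem norm_eq_tsum_of_nonneg {g : EllOne} (hg : ∀ i, 0 ≤ g i) : ‖g‖ = ∑' i, g i := by
  rw [norm_eq]; exact tsum_congr fun i => abs_of_nonneg (hg i)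

/-- The `i`-th vector of the standard basis of `ℓ₁`. -/
noncomputable def basis (i : ℕ) : EllOne := lp.single 1 i (1 : ℝ)

@[simp] theorem norm_basis (i : ℕ) : ‖basis i‖ = 1 := by
  simp [basis, lp.norm_single]

theorem basis_apply (i j : ℕ) : basis i j = if j = i then 1 else 0 := by
  simp [basis, lp.single_apply, Pi.single_apply]

theorem hasSum_basis (g : EllOne) : HasSum (fun i => g i • basis i) g := by
  have := lp.hasSum_single (E := fun _ : ℕ => ℝ) (p := 1) (by norm_num) g
  refine this.congr_fun ?_ |> fun h => h
  intro i
  rw [basis, ← lp.single_smul]; simp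

section Lift

variable {Z : Type*} [NormedAddCommGroup Z] [NormedSpace ℝ Z]

theorem hasSum_map (A : EllOne →L[ℝ] Z) (g : EllOne) :
    HasSum (fun k => g k • A (basis k)) (A g) := by
  simpa using A.hasSum (hasSum_basis g)

variable [CompleteSpace Z]

theorem summable_smul {u : ℕ → Z} {M : ℝ} (hu : ∀ k, ‖u k‖ ≤ M) (g : EllOne) :
    Summable fun k => g k • u k := by
  refine Summable.of_norm_bounded ((summable_abs g).mul_right M) fun k => ?_
  rw [norm_smul, Real.norm_eq_abs]
  exact mul_le_mul_of_nonneg_left (hu k) (abs_nonneg _)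

/-- The continuous linear map on `ℓ₁` that sends the standard basis to a bounded sequence. -/
noncomputable def lift (u : ℕ → Z) (M : ℝ) (hu : ∀ k, ‖u k‖ ≤ M) : EllOne →L[ℝ] Z :=
  LinearMap.mkContinuous
    { toFun := fun g => ∑' k, g k • u k
      map_add' := fun f g => by
        rw [← (summable_smul hu f).tsum_add (summable_smul hu g)]
        exact tsum_congr fun k => by simp [add_smul]
      map_smul' := fun c f => by
        rw [RingHom.id_apply, ← (summable_smul hu f).tsum_const_smul c]
        exact tsum_congr fun k => by simp [mul_smul] } M fun g => by
      have : ‖∑' k, g k • u k‖ ≤ ∑' k, |g k| * M := by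
        refine tsum_of_norm_bounded ((summable_abs g).mul_right M).hasSum fun k => ?_
        rw [norm_smul, Real.norm_eq_abs]
        exact mul_le_mul_of_nonneg_left (hu k) (abs_nonneg _)
      rw [tsum_mul_right, ← norm_eq, mul_comm] at this
      exact this

theorem lift_apply (u : ℕ → Z) (M : ℝ) (hu : ∀ k, ‖u k‖ ≤ M) (g : EllOne) :
    lift u M hu g = ∑' k, g k • u k := rfl

@[simp] theorem lift_basis (u : ℕ → Z) (M : ℝ) (hu : ∀ k, ‖u k‖ ≤ M) (k : ℕ) :
    lift u M hu (basis k) = u k := by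
  rw [lift_apply, tsum_eq_single k]
  · simp [basis_apply]
  · intro j hj; simp [basis_apply, hj]

end Lift

theorem isSeparable_univ : IsSeparable (Set.univ : Set EllOne) := by
  have h1 : IsSeparable (Set.range basis) := (Set.countable_range _).isSeparable
  have h2 := h1.span (R := ℝ)
  refine h2.closure.mono fun g _ => ?_
  have := hasSum_basis g
  refine mem_closure_of_tendsto this (Eventually.of_forall fun s => ?_)
  exact Submodule.sum_mem _ fun i _ => Submodule.smul_mem _ _ (Submodule.subset_span ⟨i, rfl⟩)

instance : SeparableSpace EllOne := isSeparable_univ_iff.mp isSeparable_univ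

/-- If `G i → 0` coordinatewise, then `‖G i + w‖ - ‖G i‖ → ‖w‖`. -/
theorem tendsto_norm_add_sub_norm {ι : Type*} {l : Filter ι} {G : ι → EllOne}
    (hG : ∀ k, Tendsto (fun i => G i k) l (𝓝 0)) (w : EllOne) :
    Tendsto (fun i => ‖G i + w‖ - ‖G i‖) l (𝓝 ‖w‖) := by
  have key : ∀ i, ‖G i + w‖ - ‖G i‖ = ∑' k, (|G i k + w k| - |G i k|) := by
    intro i
    rw [norm_eq, norm_eq, ← (summable_abs (G i + w)).tsum_sub (summable_abs (G i))]
    rfl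
  simp_rw [key]
  rw [norm_eq]
  refine tendsto_tsum_of_dominated_convergence (bound := fun k => |w k|) (summable_abs w)
    (fun k => ?_) (Eventually.of_forall fun i k => ?_)
  · have h := ((hG k).add_const (w k)).abs.sub (hG k).abs
    simpa using h
  · rw [Real.norm_eq_abs]
    have := abs_abs_sub_abs_le_abs_sub (G i k + w k) (G i k)
    simpa using this

/-- A coordinatewise limit of a bounded family in `ℓ₁` along an ultrafilter. -/
theorem exists_coordinatewise_limit {ι : Type*} (U : Ultrafilter ι) {G : ι → EllOne} {M : ℝ}
    (hG : ∀ᶠ i in U, ‖G i‖ ≤ M) :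
    ∃ y : EllOne, ‖y‖ ≤ M ∧ ∀ k, Tendsto (fun i => G i k) U (𝓝 (y k)) := by
  have h1 : ∀ k, ∃ a, Tendsto (fun i => G i k) U (𝓝 a) := by
    intro k
    have hc : IsCompact (Set.Icc (-M) M) := isCompact_Icc
    obtain ⟨a, -, ha⟩ := hc.ultrafilter_le_nhds (U.map fun i => G i k) (by
      rw [le_principal_iff]
      change ∀ᶠ i in (U : Filter ι), G i k ∈ Set.Icc (-M) M
      filter_upwards [hG] with i hi
      exact abs_le.mp ((abs_apply_le _ k).trans hi))
    exact ⟨a, ha⟩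
  choose a ha using h1
  have h2 : ∀ s : Finset ℕ, ∑ k ∈ s, |a k| ≤ M := by
    intro s
    refine le_of_tendsto (tendsto_finsetSum s fun k _ => (ha k).abs) ?_
    filter_upwards [hG] with i hi
    exact (sum_abs_le _ _).trans hi
  have h3 : Summable fun k => |a k| :=
    summable_of_sum_le (fun _ => abs_nonneg _) h2
  refine ⟨ofSummable a h3, ?_, ha⟩
  rw [norm_eq]
  exact h3.tsum_le_of_sum_le h2

end EllOne

/-! ### The weak-star topology on `ℓ₁` and separability of the predual. -/

section WeakStar

variable {X : Type u} [NormedAddCommGroup X] [NormedSpace ℝ X]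

/-- The linear identification of `ℓ₁` with the dual of `X` in its weak-star topology. -/
noncomputable def wk (Φ : StrongDual ℝ X ≃ₗᵢ[ℝ] EllOne) : EllOne ≃ₗ[ℝ] WeakDual ℝ X :=
  Φ.symm.toLinearEquiv.trans StrongDual.toWeakDual

@[simp] theorem wk_apply (Φ : StrongDual ℝ X ≃ₗᵢ[ℝ] EllOne) (g : EllOne) (x : X) :
    wk Φ g x = Φ.symm g x := rfl

theorem isCompact_sigma_iff (Φ : StrongDual ℝ X ≃ₗᵢ[ℝ] EllOne) (C : Set EllOne) :
    @IsCompact EllOne (sigmaTopology Φ) C ↔ IsCompact (wk Φ '' C) := by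
  let _ := sigmaTopology Φ
  exact (Topology.IsInducing.mk rfl : Topology.IsInducing (wk Φ)).isCompact_iff

theorem continuous_wk (Φ : StrongDual ℝ X ≃ₗᵢ[ℝ] EllOne) : Continuous (wk Φ) := by
  have h : Continuous fun g : EllOne => Φ.symm g := Φ.symm.continuous
  exact NormedSpace.Dual.toWeakDual_continuous.comp h

theorem tendsto_wk_iff (Φ : StrongDual ℝ X ≃ₗᵢ[ℝ] EllOne) {ι : Type*} {l : Filter ι}
    {G : ι → EllOne} {g : EllOne} :
    Tendsto (fun i => wk Φ (G i)) l (𝓝 (wk Φ g)) ↔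
      ∀ x, Tendsto (fun i => Φ.symm (G i) x) l (𝓝 (Φ.symm g x)) := by
  exact tendsto_iff_forall_eval_tendsto_topDualPairing

theorem abs_symm_apply_le (Φ : StrongDual ℝ X ≃ₗᵢ[ℝ] EllOne) (g : EllOne) (x : X) :
    |Φ.symm g x| ≤ ‖g‖ * ‖x‖ := by
  simpa using (Φ.symm g).le_opNorm x

theorem isCompact_wk_closedBall (Φ : StrongDual ℝ X ≃ₗᵢ[ℝ] EllOne) (y : EllOne) (r : ℝ) :
    IsCompact (wk Φ '' Metric.closedBall y r) := by
  convert WeakDual.isCompact_closedBall (Φ.symm y) r using 1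
  ext f
  constructor
  · rintro ⟨g, hg, rfl⟩
    have : dist (Φ.symm g) (Φ.symm y) ≤ r := by simpa using hg
    exact this
  · intro hf
    refine ⟨Φ (WeakDual.toStrongDual f), ?_, ?_⟩
    · have h : dist (WeakDual.toStrongDual f) (Φ.symm y) ≤ r := hf
      rw [Metric.mem_closedBall, ← Φ.symm.dist_map]
      simpa using h
    · simp [wk]

/-- A normed space with separable dual is separable. -/
theorem separableSpace_of_separable_dual [SeparableSpace (StrongDual ℝ X)] :
    SeparableSpace X := by
  set f := denseSeq (StrongDual ℝ X) with hf
  have h : ∀ n, ∃ x : X, ‖x‖ ≤ 1 ∧ ‖f n‖ / 2 ≤ ‖f n x‖ := by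
    intro n
    rcases eq_or_ne (f n) 0 with h0 | h0
    · exact ⟨0, by simp, by simp [h0]⟩
    · have hpos : 0 < ‖f n‖ := norm_pos_iff.mpr h0
      obtain ⟨x, hx, hx2⟩ := (f n).exists_lt_apply_of_lt_opNorm (half_lt_self hpos)
      exact ⟨x, hx.le, hx2.le⟩
  choose x hx1 hx2 using h
  set p := (Submodule.span ℝ (Set.range x)).topologicalClosure with hp
  have hsep : IsSeparable (p : Set X) :=
    ((Set.countable_range x).isSeparable.span (R := ℝ)).closure
  have htop : p = ⊤ := by
    by_contra hne
    obtain ⟨z, hz⟩ : ∃ z, z ∉ p := by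
      by_contra hcon
      push Not at hcon
      exact hne (eq_top_iff.mpr fun z _ => hcon z)
    have hcl : IsClosed (p : Set X) := Submodule.isClosed_topologicalClosure _
    have hne' : ‖p.mkQ z‖ ≠ 0 := by
      intro h0
      exact hz ((Submodule.Quotient.mk_eq_zero p).mp (norm_eq_zero.mp h0))
    obtain ⟨q, -, hq⟩ := exists_dual_vector ℝ (p.mkQ z) hne'
    set g : StrongDual ℝ X := q.comp p.mkQL with hg
    have hg0 : ∀ y ∈ p, g y = 0 := by
      intro y hy
      have : p.mkQ y = 0 := (Submodule.Quotient.mk_eq_zero p).mpr hy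
      change q (p.mkQ y) = 0
      rw [this, map_zero]
    have hgz : g z ≠ 0 := by
      change q (p.mkQ z) ≠ 0
      rw [hq]; exact_mod_cast hne'
    have hgpos : 0 < ‖g‖ := norm_pos_iff.mpr fun h => hgz (by simp [h])
    -- Since `g` vanishes at `x n`, `‖f n‖ ≤ 2‖g - f n‖`, so `‖g‖ ≤ 3‖g - f n‖`; a distance below
    -- `‖g‖ / 4` is contradictory.
    obtain ⟨n, hn⟩ := (denseRange_denseSeq (StrongDual ℝ X)).exists_dist_lt g
      (show 0 < ‖g‖ / 4 by positivity)
    rw [dist_eq_norm] at hn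
    have h1 : ‖f n (x n)‖ ≤ ‖g - f n‖ := by
      have h2 : f n (x n) = -((g - f n) (x n)) := by
        simp [hg0 (x n) (Submodule.le_topologicalClosure _ (Submodule.subset_span ⟨n, rfl⟩))]
      rw [h2, norm_neg]
      exact ((g - f n).le_opNorm _).trans (mul_le_of_le_one_right (norm_nonneg _) (hx1 n))
    have h3 := hx2 n
    have h4 : ‖g‖ ≤ ‖g - f n‖ + ‖f n‖ := by simpa using norm_add_le (g - f n) (f n)
    linarith
  exact isSeparable_univ_iff.mp (by rw [htop] at hsep; simpa using hsep)

end WeakStar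

/-! ### Limits of atomic measures when mass escapes. -/

section LimitMeasure

open MeasureTheory

variable {K : Type*} [MeasurableSpace K]

/-- The atomic measure with masses `|g i|` at the points `v i`. -/
noncomputable def atomicMeasure (v : ℕ → K) (g : EllOne) : Measure K :=
  Measure.sum fun i => ENNReal.ofReal |g i| • Measure.dirac (v i)

theorem atomicMeasure_apply (v : ℕ → K) (g : EllOne) {s : Set K} (hs : MeasurableSet s) :
    atomicMeasure v g s = ∑' i, ENNReal.ofReal |g i| * s.indicator 1 (v i) := by
  rw [atomicMeasure, Measure.sum_apply _ hs]
  simp [Measure.dirac_apply' _ hs]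

theorem isProbabilityMeasure_atomicMeasure (v : ℕ → K) {g : EllOne} (hg : ‖g‖ = 1) :
    IsProbabilityMeasure (atomicMeasure v g) := by
  constructor
  rw [atomicMeasure_apply _ _ MeasurableSet.univ]
  simp only [Set.indicator_univ, Pi.one_apply, mul_one]
  rw [← ENNReal.ofReal_tsum_of_nonneg (fun i => abs_nonneg _) (EllOne.summable_abs g),
    ← EllOne.norm_eq, hg, ENNReal.ofReal_one]

theorem integral_atomicMeasure [MeasurableSingletonClass K] (v : ℕ → K) (g : EllOne) (φ : K → ℝ) :
    ∫ z, φ z ∂atomicMeasure v g = ∑' i, |g i| * φ (v i) := by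
  rw [atomicMeasure, integral_sum_dirac fun i => ENNReal.ofReal_ne_top]
  simp

variable [TopologicalSpace K] [BorelSpace K]

/-- Only the first `N` atoms can charge the complement of the closed tail. -/
theorem le_atomicMeasure_closure (v : ℕ → K) {g : EllOne} (hg : ‖g‖ = 1) (N : ℕ) :
    ENNReal.ofReal (1 - ∑ i ∈ Finset.range N, |g i|) ≤
      atomicMeasure v g (closure (v '' Set.Ici N)) := by
  have := isProbabilityMeasure_atomicMeasure v hg
  set F := closure (v '' Set.Ici N)
  have hF : MeasurableSet F := isClosed_closure.measurableSet
  have h1 : atomicMeasure v g Fᶜ ≤ ENNReal.ofReal (∑ i ∈ Finset.range N, |g i|) := by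
    rw [atomicMeasure_apply _ _ hF.compl, tsum_eq_sum (s := Finset.range N),
      ENNReal.ofReal_sum_of_nonneg fun i _ => abs_nonneg _]
    · refine Finset.sum_le_sum fun i _ => ?_
      refine mul_le_of_le_one_right' ?_
      exact Set.indicator_le_self' (by simp) _ 
    · intro i hi
      have : v i ∈ F := subset_closure ⟨i, by simpa using hi, rfl⟩
      simp [this]
  rw [ENNReal.ofReal_sub _ (Finset.sum_nonneg fun i _ => abs_nonneg _), ENNReal.ofReal_one,
    tsub_le_iff_right]
  calc (1 : ENNReal) = atomicMeasure v g F + atomicMeasure v g Fᶜ := by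
        rw [measure_add_measure_compl hF, measure_univ]
    _ ≤ _ := by gcongr

/-- The coordinatewise limit has norm below one, so a fixed amount of mass leaves every finite set
of indices. By the portmanteau theorem every closed tail of `v` keeps that mass in the limit, and
the closed tails intersect in the cluster set. -/
theorem exists_limit_measure [CompactSpace K] [MetrizableSpace K] (v : ℕ → K)
    (U : Ultrafilter EllOne) (hU : ∀ᶠ g in (U : Filter EllOne), ‖g‖ = 1)
    {y : EllOne} (hy : ‖y‖ < 1) (hUy : ∀ k, Tendsto (fun g : EllOne => g k) U (𝓝 (y k))) :
    ∃ μ : ProbabilityMeasure K,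
      (∀ φ : C(K, ℝ), Tendsto (fun g : EllOne => ∑' i, |g i| * φ (v i)) U
        (𝓝 (∫ z, φ z ∂(μ : Measure K)))) ∧
      (μ : Measure K) {z | MapClusterPt z atTop v} ≠ 0 := by
  classical
  -- The Dirac branch is a junk value, off the norm-one set that belongs to `U`.
  let m : EllOne → ProbabilityMeasure K := fun g =>
    if h : ‖g‖ = 1 then ⟨atomicMeasure v g, isProbabilityMeasure_atomicMeasure v h⟩
    else ⟨Measure.dirac (v 0), inferInstance⟩
  have hm : ∀ g, ‖g‖ = 1 → (m g : Measure K) = atomicMeasure v g := by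
    intro g hg
    simp [m, hg]
  obtain ⟨μ, -, hμ⟩ := isCompact_univ.ultrafilter_le_nhds (U.map m) (by simp)
  have hμ' : Tendsto m U (𝓝 μ) := hμ
  refine ⟨μ, fun φ => ?_, ?_⟩
  · have h := (ProbabilityMeasure.tendsto_iff_forall_integral_tendsto.mp hμ')
      (BoundedContinuousFunction.mkOfCompact φ)
    refine h.congr' ?_
    filter_upwards [hU] with g hg
    rw [hm g hg]
    exact integral_atomicMeasure v g φ
  · have hF : ∀ N, ENNReal.ofReal ((1 - ‖y‖) / 2) ≤ (μ : Measure K) (closure (v '' Set.Ici N)) := by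
      intro N
      refine le_trans ?_ (ProbabilityMeasure.limsup_measure_closed_le_of_tendsto hμ'
        isClosed_closure)
      have h1 : Tendsto (fun g : EllOne => ∑ i ∈ Finset.range N, |g i|) U
          (𝓝 (∑ i ∈ Finset.range N, |y i|)) := tendsto_finsetSum _ fun k _ => (hUy k).abs
      -- The midpoint of `‖y‖` and `1` leaves the mass `(1 - ‖y‖) / 2` for the tail, independently
      -- of `N`.
      have h2 : ∑ i ∈ Finset.range N, |y i| < (1 + ‖y‖) / 2 :=
        (EllOne.sum_abs_le y _).trans_lt (by linarith)
      refine le_limsup_of_frequently_le (Eventually.frequently ?_)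
      filter_upwards [hU, h1.eventually_lt_const h2] with g hg hlt
      rw [hm g hg]
      refine le_trans (ENNReal.ofReal_le_ofReal ?_) (le_atomicMeasure_closure v hg N)
      linarith
    have hset : {z | MapClusterPt z atTop v} = ⋂ N, closure (v '' Set.Ici N) := by
      ext z
      simp only [Set.mem_ofPred_eq, Set.mem_iInter, mapClusterPt_iff_frequently,
        frequently_atTop, mem_closure_iff_nhds]
      constructor
      · intro h N t ht
        obtain ⟨b, hb, hb'⟩ := h t ht N
        exact ⟨v b, hb', b, hb, rfl⟩
      · intro h t ht N
        obtain ⟨_, hb', b, hb, rfl⟩ := h N t ht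
        exact ⟨b, hb, hb'⟩
    rw [hset]
    have hanti : Antitone fun N => closure (v '' Set.Ici N) := fun a b hab =>
      closure_mono (Set.image_mono (Set.Ici_subset_Ici.mpr hab))
    have hlim := tendsto_measure_iInter_atTop (μ := (μ : Measure K))
      (s := fun N => closure (v '' Set.Ici N))
      (fun N => isClosed_closure.measurableSet.nullMeasurableSet) hanti
      ⟨0, measure_ne_top _ _⟩
    have h3 := ge_of_tendsto' hlim hF
    intro h0
    rw [h0] at h3
    have : 0 < ENNReal.ofReal ((1 - ‖y‖) / 2) := ENNReal.ofReal_pos.mpr (by linarith)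
    exact absurd h3 (not_le.mpr this)

end LimitMeasure

/-! ### From a non-compact convex part of the sphere to a convergent signed subsequence. -/

/-- Midpoints stay on the sphere, so the triangle inequality for `f + g` is an equality, hence an
equality in each coordinate. Two elements therefore never have opposite strict signs at the same
index. -/
theorem EllOne.exists_signs {D : Set EllOne} (hD : Convex ℝ D) (hn : ∀ g ∈ D, ‖g‖ = 1) :
    ∃ ε : ℕ → ℝ, (∀ i, |ε i| = 1) ∧ ∀ g ∈ D, ∀ i, ε i * g i = |g i| := by
  have key : ∀ f ∈ D, ∀ g ∈ D, ∀ i, |f i + g i| = |f i| + |g i| := by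
    intro f hf g hg
    have h1 : ‖f + g‖ = 2 := by
      have h := hn _ (hD hf hg (show (0 : ℝ) ≤ 1 / 2 by norm_num) (show (0 : ℝ) ≤ 1 / 2 by norm_num)
        (by norm_num))
      rw [← smul_add, norm_smul] at h
      norm_num at h
      linarith
    have h2 : HasSum (fun i => |f i| + |g i| - |f i + g i|) (1 + 1 - 2) := by
      have hf' := (EllOne.summable_abs f).hasSum
      have hg' := (EllOne.summable_abs g).hasSum
      have hfg := (EllOne.summable_abs (f + g)).hasSum
      rw [← EllOne.norm_eq] at hf' hg' hfg
      rw [hn f hf] at hf'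
      rw [hn g hg] at hg'
      rw [h1] at hfg
      exact (hf'.add hg').sub hfg
    norm_num at h2
    have h3 := (hasSum_zero_iff_of_nonneg fun i => sub_nonneg.mpr (abs_add_le (f i) (g i))).mp h2
    intro i
    have := congrFun h3 i
    simp only [Pi.zero_apply] at this
    linarith
  have hi : ∀ i, ∃ e : ℝ, |e| = 1 ∧ ∀ g ∈ D, e * g i = |g i| := by
    intro i
    by_cases h : ∀ g ∈ D, 0 ≤ g i
    · exact ⟨1, by simp, fun g hg => by rw [one_mul, abs_of_nonneg (h g hg)]⟩
    · push Not at h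
      obtain ⟨f, hf, hfi⟩ := h
      refine ⟨-1, by simp, fun g hg => ?_⟩
      have h1 := key f hf g hg i
      have : g i ≤ 0 := by
        by_contra hpos
        push Not at hpos
        rw [abs_of_neg hfi, abs_of_pos hpos] at h1
        rcases abs_cases (f i + g i) with h2 | h2 <;> linarith [h2.1]
      rw [abs_of_nonpos this]; ring
  choose ε hε hεD using hi
  exact ⟨ε, hε, fun g hg i => hεD i g hg⟩

section

variable {X : Type u} [NormedAddCommGroup X] [NormedSpace ℝ X]

theorem separableSpace_of_dual_equiv (Φ : StrongDual ℝ X ≃ₗᵢ[ℝ] EllOne) : SeparableSpace X := by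
  have : SeparableSpace (StrongDual ℝ X) :=
    Φ.symm.surjective.denseRange.separableSpace Φ.symm.continuous
  exact separableSpace_of_separable_dual

-- Closed balls are weak-star closed, and in the separable space `ℓ₁` every norm-open set is a
-- countable union of them. Weak-star continuity thus gives norm measurability, as needed for
-- Bochner integrals.
open MeasureTheory in
theorem measurable_wk_symm (Φ : StrongDual ℝ X ≃ₗᵢ[ℝ] EllOne) [MeasurableSpace EllOne]
    [BorelSpace EllOne] {K : Type*} [TopologicalSpace K] [MeasurableSpace K]
    [OpensMeasurableSpace K] {j : K → WeakDual ℝ X} (hj : Continuous j) :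
    Measurable fun z => (wk Φ).symm (j z) := by
  refine measurable_of_isOpen fun O hO => ?_
  obtain ⟨s, hsc, hsd⟩ := exists_countable_dense EllOne
  have hO' : O = ⋃ c ∈ s, ⋃ q : ℚ, ⋃ _ : Metric.closedBall c (q : ℝ) ⊆ O,
      Metric.closedBall c (q : ℝ) := by
    ext g
    simp only [Set.mem_iUnion]
    constructor
    · intro hg
      obtain ⟨r, hr, hball⟩ := Metric.isOpen_iff.mp hO g hg
      obtain ⟨q, hq0, hqr⟩ := exists_rat_btwn (show (0 : ℝ) < r / 2 by positivity)
      obtain ⟨c, hc, hcg⟩ := hsd.exists_dist_lt g hq0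
      refine ⟨c, hc, q, fun h hh => hball ?_, hcg.le⟩
      rw [Metric.mem_closedBall] at hh
      rw [Metric.mem_ball]
      have := dist_triangle h c g
      rw [dist_comm] at hcg
      linarith
    · rintro ⟨c, hc, q, hsub, hg⟩
      exact hsub hg
  rw [hO']
  simp only [Set.preimage_iUnion]
  refine MeasurableSet.biUnion hsc fun c _ => MeasurableSet.iUnion fun q =>
    MeasurableSet.iUnion fun _ => ?_
  have h1 : (fun z => (wk Φ).symm (j z)) ⁻¹' Metric.closedBall c (q : ℝ) =
      j ⁻¹' (wk Φ '' Metric.closedBall c (q : ℝ)) := by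
    ext z
    simp only [Set.mem_preimage, Set.mem_image]
    constructor
    · intro h; exact ⟨_, h, by simp⟩
    · rintro ⟨g, hg, hgz⟩
      rw [← hgz]; simpa using hg
  rw [h1]
  exact ((isCompact_wk_closedBall Φ c q).isClosed.preimage hj).measurableSet

open MeasureTheory in
/-- A weak-star compact convex subset of the unit sphere of `ℓ₁` that is not norm compact forces a
signed subsequence of the standard basis to converge weak-star to a point of norm one. -/
theorem exists_basis_subseq_tendsto (Φ : StrongDual ℝ X ≃ₗᵢ[ℝ] EllOne) {D : Set EllOne}
    (hconv : Convex ℝ D) (hcomp : IsCompact (wk Φ '' D)) (hn : ∀ g ∈ D, ‖g‖ = 1)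
    (hnc : ¬ IsCompact D) :
    ∃ ε : ℕ → ℝ, (∀ i, |ε i| = 1) ∧ ∃ f : EllOne, ‖f‖ = 1 ∧ (∀ i, ε i * f i = |f i|) ∧
      ∃ n : ℕ → ℕ, StrictMono n ∧
        Tendsto (fun k => wk Φ (ε (n k) • EllOne.basis (n k))) atTop (𝓝 (wk Φ f)) := by
  have hsepX := separableSpace_of_dual_equiv Φ
  obtain ⟨ε, hε, hεD⟩ := EllOne.exists_signs hconv hn
  refine ⟨ε, hε, ?_⟩
  have hU0 : ∃ U : Ultrafilter EllOne, D ∈ U ∧ ∀ g ∈ D, ¬ (U : Filter EllOne) ≤ 𝓝 g := by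
    by_contra hcon
    push Not at hcon
    refine hnc (isCompact_iff_ultrafilter_le_nhds.mpr fun U hU => hcon U (by simpa using hU))
  obtain ⟨U, hUD, hUn⟩ := hU0
  have hU1 : ∀ᶠ g in (U : Filter EllOne), ‖g‖ = 1 := by
    filter_upwards [hUD] with g hg using hn g hg
  obtain ⟨_, ⟨x, hxD, rfl⟩, hx⟩ := hcomp.ultrafilter_le_nhds (U.map (wk Φ)) (by
    rw [le_principal_iff]
    exact mem_map.mpr (mem_of_superset hUD fun g hg => ⟨g, hg, rfl⟩))
  have hx' : Tendsto (wk Φ) U (𝓝 (wk Φ x)) := hx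
  obtain ⟨y, hy1, hy⟩ := EllOne.exists_coordinatewise_limit U (G := id) (M := 1)
    (hU1.mono fun g hg => hg.le)
  simp only [id_eq] at hy
  -- If no mass were lost, `‖g‖ - ‖g - y‖ → ‖y‖ = 1` would force `g → y` in norm, with `y = x ∈ D`,
  -- against the choice of `U`.
  have hylt : ‖y‖ < 1 := by
    refine lt_of_le_of_ne hy1 fun hy1 => ?_
    have h1 := EllOne.tendsto_norm_add_sub_norm (l := (U : Filter EllOne)) (G := fun g => g - y)
      (fun k => by simpa using (hy k).sub_const (y k)) y
    have h2 : Tendsto (fun g : EllOne => ‖g - y‖) U (𝓝 0) := by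
      rw [hy1] at h1
      have h3 := (tendsto_const_nhds (x := (1 : ℝ))).sub h1
      rw [sub_self] at h3
      refine h3.congr' ?_
      filter_upwards [hU1] with g hg
      simp [hg]
    have h3 : (U : Filter EllOne) ≤ 𝓝 y := by
      have := tendsto_iff_norm_sub_tendsto_zero.mpr h2
      exact this
    have h4 : Tendsto (wk Φ) U (𝓝 (wk Φ y)) := ((continuous_wk Φ).tendsto y).mono_left h3
    have h5 : x = y := (wk Φ).injective (tendsto_nhds_unique hx' h4)
    exact hUn x hxD (h5 ▸ h3)
  -- the weak-star unit ball
  set K := wk Φ '' Metric.closedBall (0 : EllOne) 1 with hK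
  have hKc : IsCompact K := isCompact_wk_closedBall Φ 0 1
  have : CompactSpace K := isCompact_iff_compactSpace.mp hKc
  -- Metrizability, from separability of `X`, serves both the limit measure and the passage from a
  -- cluster point to a subsequence.
  have : MetrizableSpace K := WeakDual.metrizable_of_isCompact ℝ X K hKc
  let _ : MeasurableSpace K := borel K
  have : BorelSpace K := ⟨rfl⟩
  let _ : MeasurableSpace EllOne := borel EllOne
  have : BorelSpace EllOne := ⟨rfl⟩
  let v : ℕ → K := fun i => ⟨wk Φ (ε i • EllOne.basis i), ε i • EllOne.basis i, by
    simp [norm_smul, hε], rfl⟩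
  obtain ⟨μ, hμ, hμ0⟩ := exists_limit_measure v U hU1 hylt hy
  let κ : K → EllOne := fun z => (wk Φ).symm z.1
  have hκm : Measurable κ := measurable_wk_symm Φ continuous_subtype_val
  have hκn : ∀ z, ‖κ z‖ ≤ 1 := by
    rintro ⟨_, g, hg, rfl⟩
    simpa [κ] using hg
  have hκi : Integrable κ (μ : Measure K) :=
    Integrable.of_bound hκm.aestronglyMeasurable 1 (Eventually.of_forall hκn)
  have hκe : ∀ z a, Φ.symm (κ z) a = (z : WeakDual ℝ X) a := by
    intro z a
    rw [← wk_apply]; simp [κ]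
  -- Each `g ∈ D` equals `∑ |g i| ε i e_i`, the barycentre of its atomic measure; testing against `a
  -- : X` passes this to the limit.
  have hbary : ∫ z, κ z ∂(μ : Measure K) = x := by
    apply Φ.symm.injective
    ext a
    let A : EllOne →L[ℝ] ℝ :=
      (ContinuousLinearMap.apply ℝ ℝ a).comp (Φ.symm : EllOne →L[ℝ] StrongDual ℝ X)
    have hA : ∀ g, A g = Φ.symm g a := fun g => rfl
    rw [← hA, ← A.integral_comp_comm hκi]
    let φ : C(K, ℝ) := ⟨fun z => (z : WeakDual ℝ X) a,
      (WeakDual.eval_continuous a).comp continuous_subtype_val⟩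
    have h1 := hμ φ
    have h2 : Tendsto (fun g : EllOne => ∑' i, |g i| * φ (v i)) U (𝓝 (Φ.symm x a)) := by
      refine ((tendsto_wk_iff Φ).mp (hx' : Tendsto (fun g => wk Φ g) U _) a).congr' ?_
      filter_upwards [hUD] with g hg
      rw [← hA, ← (EllOne.hasSum_map A g).tsum_eq]
      refine tsum_congr fun i => ?_
      have h3 : φ (v i) = ε i * A (EllOne.basis i) := by
        change wk Φ (ε i • EllOne.basis i) a = _
        rw [wk_apply, ← hA, map_smul, smul_eq_mul]
      rw [h3, ← hεD g hg i, smul_eq_mul]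
      have h4 : ε i * ε i = 1 := by
        rw [← abs_mul_abs_self, hε]; norm_num
      linear_combination (-(g i * A (EllOne.basis i))) * h4
    rw [← tendsto_nhds_unique h1 h2]
    exact integral_congr_ae (Eventually.of_forall fun z => by
      simp only [hA, hκe]; rfl)
  -- The functional `s` is dominated by the norm and equals it on `D`. Its average over `μ` is `s x
  -- = 1`, so it is one almost everywhere, in particular at some point of the non-null cluster set.
  let s : EllOne →L[ℝ] ℝ := EllOne.lift ε 1 fun k => (hε k).le
  have hs : ∀ g, s g = ∑' i, ε i * g i := fun g =>
    tsum_congr fun i => by rw [smul_eq_mul, mul_comm]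
  have hsle : ∀ g, s g ≤ ‖g‖ := by
    intro g
    rw [hs, EllOne.norm_eq]
    have habs : ∀ i, |ε i * g i| = |g i| := fun i => by rw [abs_mul, hε, one_mul]
    refine Summable.tsum_le_tsum (fun i => ?_) ?_ (EllOne.summable_abs g)
    · rw [← habs]; exact le_abs_self _
    · exact Summable.of_abs (by simpa only [habs] using EllOne.summable_abs g)
  have hsx : ∫ z, s (κ z) ∂(μ : Measure K) = 1 := by
    rw [s.integral_comp_comm hκi, hbary, hs, ← hn x hxD, EllOne.norm_eq]
    exact tsum_congr (hεD x hxD)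
  have hae : ∀ᵐ z ∂(μ : Measure K), s (κ z) = 1 := by
    have h1 : 0 ≤ᵐ[(μ : Measure K)] fun z => 1 - s (κ z) :=
      Eventually.of_forall fun z => sub_nonneg.mpr ((hsle _).trans (hκn z))
    have h2 := (integral_eq_zero_iff_of_nonneg_ae h1
      ((integrable_const 1).sub (s.integrable_comp hκi))).mp (by
        rw [integral_sub (integrable_const 1) (s.integrable_comp hκi), hsx]; simp)
    filter_upwards [h2] with z hz
    simp only [Pi.zero_apply] at hz
    linarith
  obtain ⟨z, hz1, hz2⟩ : ∃ z, MapClusterPt z atTop v ∧ s (κ z) = 1 := by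
    by_contra hcon
    push Not at hcon
    refine hμ0 (measure_mono_null (fun z hz => hcon z hz) hae)
  obtain ⟨n, hn1, hn2⟩ := hz1.tendsto_subseq
  have hfn : ‖κ z‖ = 1 := le_antisymm (hκn z) (hz2 ▸ hsle _)
  refine ⟨κ z, hfn, ?_, n, hn1, ?_⟩
  · have h1 : HasSum (fun i => |κ z i| - ε i * κ z i) (1 - 1) := by
      have ha := (EllOne.summable_abs (κ z)).hasSum
      rw [← EllOne.norm_eq, hfn] at ha
      have hb := (EllOne.summable_smul (u := ε) (M := 1) (fun k => (hε k).le) (κ z)).hasSum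
      rw [← EllOne.lift_apply ε 1 fun k => (hε k).le] at hb
      change HasSum _ (s (κ z)) at hb
      rw [hz2] at hb
      refine (ha.sub hb).congr_fun ?_ |> id
      intro i; rw [smul_eq_mul, mul_comm]
    rw [sub_self] at h1
    have h2 := (hasSum_zero_iff_of_nonneg fun i => by
      simp only [sub_nonneg]
      calc ε i * κ z i ≤ |ε i * κ z i| := le_abs_self _
        _ = _ := by rw [abs_mul, hε, one_mul]).mp h1
    intro i
    have := congrFun h2 i
    simp only [Pi.zero_apply] at this
    linarith
  · have h1 : wk Φ (κ z) = z := by simp [κ]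
    rw [h1]
    exact (continuous_subtype_val.tendsto z).comp hn2

end

/-! ### Isometric copies of `ℓ₁` spanned by disjoint blocks. -/

namespace EllOne

theorem norm_add_of_disjoint {f g : EllOne} (h : ∀ i, f i = 0 ∨ g i = 0) :
    ‖f + g‖ = ‖f‖ + ‖g‖ := by
  rw [norm_eq, norm_eq, norm_eq, ← (summable_abs f).tsum_add (summable_abs g)]
  refine tsum_congr fun i => ?_
  change |f i + g i| = _
  rcases h i with h | h <;> simp [h]

theorem lift_eval {u : ℕ → EllOne} {M : ℝ} (hu : ∀ k, ‖u k‖ ≤ M) (g : EllOne) (i : ℕ) :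
    lift u M hu g i = ∑' k, g k * u k i := by
  have h := (lp.evalCLM ℝ (fun _ : ℕ => ℝ) 1 i).hasSum (summable_smul hu g).hasSum
  exact h.tsum_eq.symm

/-- Norms add over disjoint supports, first for partial sums and then in the limit. -/
theorem norm_lift_of_disjoint {u : ℕ → EllOne} (hu : ∀ k, ‖u k‖ = 1)
    (hd : ∀ k l, k ≠ l → ∀ i, u k i = 0 ∨ u l i = 0) (g : EllOne) :
    ‖lift u 1 (fun k => (hu k).le) g‖ = ‖g‖ := by
  have hfin : ∀ N, ‖∑ k ∈ Finset.range N, g k • u k‖ = ∑ k ∈ Finset.range N, |g k| := by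
    intro N
    induction N with
    | zero => simp
    | succ N ih =>
      rw [Finset.sum_range_succ, Finset.sum_range_succ, norm_add_of_disjoint, ih, norm_smul, hu,
        mul_one, Real.norm_eq_abs]
      intro i
      by_cases h : u N i = 0
      · right; simp [h]
      · left
        rw [lp.coeFn_sum, Finset.sum_apply]
        refine Finset.sum_eq_zero fun k hk => ?_
        have := (hd k N (Finset.mem_range.mp hk).ne i).resolve_right h
        simp [this]
  have h1 := (summable_smul (fun k => (hu k).le) g).hasSum.tendsto_sum_nat.norm
  simp_rw [hfin] at h1
  rw [norm_eq g]
  exact tendsto_nhds_unique h1 (summable_abs g).hasSum.tendsto_sum_nat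

end EllOne

/-- From a signed subsequence of the basis that converges weak-star to a compatible point of norm
one, one obtains an isometric copy of `ℓ₁` whose basis converges weak-star to a positive norm-one
combination of itself. -/
theorem exists_isometry_of_basis_subseq {X : Type u} [NormedAddCommGroup X] [NormedSpace ℝ X]
    (Φ : StrongDual ℝ X ≃ₗᵢ[ℝ] EllOne) {ε : ℕ → ℝ} (hε : ∀ i, |ε i| = 1) {f : EllOne}
    (hf : ‖f‖ = 1) (hεf : ∀ i, ε i * f i = |f i|) {n : ℕ → ℕ} (hn : StrictMono n)
    (hlim : Tendsto (fun k => wk Φ (ε (n k) • EllOne.basis (n k))) atTop (𝓝 (wk Φ f))) :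
    ∃ (J : EllOne →ₗᵢ[ℝ] EllOne) (α : EllOne), (∀ k, 0 ≤ α k) ∧ ‖α‖ = 1 ∧
      Tendsto (fun k => wk Φ (J (EllOne.basis k))) atTop (𝓝 (wk Φ (J α))) := by
  classical
  obtain ⟨j, hj⟩ : ∃ j, f j ≠ 0 := by
    by_contra hcon
    push Not at hcon
    have : f = 0 := EllOne.ext fun i => by simpa using hcon i
    simp [this] at hf
  -- Since `n k ≥ k`, dropping `j + 1` terms puts all remaining indices above `j`. So `f` keeps a
  -- non-zero part `p` off the range of `n'`.
  let n' : ℕ → ℕ := fun k => n (k + (j + 1))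
  have hn' : StrictMono n' := fun a b hab => hn (by omega)
  have hjn : j ∉ Set.range n' := by
    rintro ⟨k, hk⟩
    have := hn.id_le (k + (j + 1))
    simp only [id_eq, n'] at this hk
    omega
  have hlim' : Tendsto (fun k => wk Φ (ε (n' k) • EllOne.basis (n' k))) atTop (𝓝 (wk Φ f)) :=
    hlim.comp (tendsto_add_atTop_nat (j + 1))
  have hps : Summable fun i => |if i ∈ Set.range n' then 0 else f i| := by
    refine (EllOne.summable_abs f).of_nonneg_of_le (fun _ => abs_nonneg _) fun i => ?_
    split_ifs <;> simp
  let p : EllOne := EllOne.ofSummable _ hps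
  have hp : ∀ i, p i = if i ∈ Set.range n' then 0 else f i := fun i => rfl
  have hp0 : p ≠ 0 := by
    intro h
    have := hp j
    rw [if_neg hjn, h] at this
    exact hj (by simpa using this.symm)
  have hc : 0 < ‖p‖ := norm_pos_iff.mpr hp0
  -- Block `0` is the normalized part of `f` off the subsequence, the others are the signed basis
  -- vectors. Then `f = ‖p‖ u 0 + ∑ |f (n' k)| u (k + 1)`, a positive combination thanks to sign
  -- compatibility.
  let u : ℕ → EllOne := fun k => Nat.casesOn k (‖p‖⁻¹ • p) fun k => ε (n' k) • EllOne.basis (n' k)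
  have hu0 : ∀ i, u 0 i = ‖p‖⁻¹ * p i := fun i => rfl
  have husucc : ∀ k i, u (k + 1) i = if i = n' k then ε (n' k) else 0 := by
    intro k i
    change ε (n' k) * EllOne.basis (n' k) i = _
    rw [EllOne.basis_apply]; split_ifs <;> simp
  have hun : ∀ k, ‖u k‖ = 1 := by
    rintro (_ | k)
    · change ‖‖p‖⁻¹ • p‖ = 1
      rw [norm_smul, norm_inv, norm_norm, inv_mul_cancel₀ hc.ne']
    · change ‖ε (n' k) • EllOne.basis (n' k)‖ = 1
      rw [norm_smul, Real.norm_eq_abs, hε, EllOne.norm_basis, mul_one]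
  have h0 : ∀ k i, u 0 i = 0 ∨ u (k + 1) i = 0 := by
    intro k i
    by_cases h : i = n' k
    · left; rw [hu0, hp, if_pos ⟨k, h.symm⟩, mul_zero]
    · right; rw [husucc, if_neg h]
  have hd : ∀ k l, k ≠ l → ∀ i, u k i = 0 ∨ u l i = 0 := by
    rintro (_ | k) (_ | l) hkl i
    · exact absurd rfl hkl
    · exact h0 l i
    · exact (h0 k i).symm
    · by_cases h : i = n' k
      · right
        rw [husucc, if_neg]
        rintro rfl
        exact hkl (by rw [hn'.injective h])
      · left; rw [husucc, if_neg h]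
  let J : EllOne →ₗᵢ[ℝ] EllOne :=
    { (EllOne.lift u 1 fun k => (hun k).le).toLinearMap with
      norm_map' := EllOne.norm_lift_of_disjoint hun hd }
  have hJb : ∀ k, J (EllOne.basis k) = u k := EllOne.lift_basis u 1 fun k => (hun k).le
  let a : ℕ → ℝ := fun k => Nat.casesOn k ‖p‖ fun k => abs (f (n' k))
  have hαs : Summable fun k => |a k| := by
    rw [← summable_nat_add_iff 1]
    simpa [a, Function.comp_def] using (EllOne.summable_abs f).comp_injective hn'.injective
  let α : EllOne := EllOne.ofSummable _ hαs
  have hα0 : α 0 = ‖p‖ := rfl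
  have hαsucc : ∀ k, α (k + 1) = |f (n' k)| := fun k => rfl
  have hJα : J α = f := by
    refine EllOne.ext fun i => ?_
    have h1 : J α i = ∑' k, α k * u k i := EllOne.lift_eval (fun k => (hun k).le) α i
    rw [h1]
    by_cases hi : i ∈ Set.range n'
    · obtain ⟨k, rfl⟩ := hi
      rw [tsum_eq_single (k + 1), husucc, if_pos rfl, hαsucc, ← hεf]
      · have h4 : ε (n' k) * ε (n' k) = 1 := by rw [← abs_mul_abs_self, hε]; norm_num
        linear_combination f (n' k) * h4
      · rintro (_ | l) hl
        · rw [hu0, hp, if_pos ⟨k, rfl⟩]; simp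
        · rw [husucc, if_neg, mul_zero]
          intro h
          exact hl (by rw [hn'.injective h])
    · rw [tsum_eq_single 0, hu0, hα0, hp, if_neg hi, mul_inv_cancel_left₀ hc.ne']
      rintro (_ | l) hl
      · exact absurd rfl hl
      · rw [husucc, if_neg, mul_zero]
        rintro rfl
        exact hi ⟨l, rfl⟩
  refine ⟨J, α, ?_, ?_, ?_⟩
  · rintro (_ | k)
    · exact hc.le
    · exact abs_nonneg _
  · rw [← J.norm_map, hJα, hf]
  · rw [← tendsto_add_atTop_iff_nat 1, hJα]
    simpa only [hJb] using hlim'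

/-! ### The positive face: weak-star compactness and the right shift. -/

namespace EllOne

/-- The positive face of the unit sphere of `ℓ₁`. -/
def positiveFace : Set EllOne := {g | (∀ i, 0 ≤ g i) ∧ ‖g‖ = 1}

theorem basis_mem_positiveFace (k : ℕ) : basis k ∈ positiveFace :=
  ⟨fun i => by rw [basis_apply]; split_ifs <;> norm_num, norm_basis k⟩

theorem norm_add_of_nonneg {f g : EllOne} (hf : ∀ i, 0 ≤ f i) (hg : ∀ i, 0 ≤ g i) :
    ‖f + g‖ = ‖f‖ + ‖g‖ := by
  rw [norm_eq_tsum_of_nonneg hf, norm_eq_tsum_of_nonneg hg, ← (summable f).tsum_add (summable g),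
    norm_eq_tsum_of_nonneg]
  · rfl
  · exact fun i => add_nonneg (hf i) (hg i)

theorem convex_positiveFace : Convex ℝ positiveFace := by
  rintro f ⟨hf, hf1⟩ g ⟨hg, hg1⟩ a b ha hb hab
  have hf' : ∀ i, 0 ≤ (a • f) i := fun i => mul_nonneg ha (hf i)
  have hg' : ∀ i, 0 ≤ (b • g) i := fun i => mul_nonneg hb (hg i)
  refine ⟨fun i => add_nonneg (hf' i) (hg' i), ?_⟩
  rw [norm_add_of_nonneg hf' hg', norm_smul, norm_smul, hf1, hg1, Real.norm_of_nonneg ha,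
    Real.norm_of_nonneg hb, mul_one, mul_one, hab]

end EllOne

/-- On the sequences `λ ≥ 0` with `∑ λ ≤ 1`, pairing with a null sequence is continuous for the
product topology. -/
theorem continuousOn_tsum_mul_of_tendsto_zero {c : ℕ → ℝ} (hc : Tendsto c atTop (𝓝 0)) :
    ContinuousOn (fun a : ℕ → ℝ => ∑' k, a k * c k)
      {a | (∀ k, 0 ≤ a k) ∧ ∀ s : Finset ℕ, ∑ k ∈ s, a k ≤ 1} := by
  -- As `∑ a ≤ 1`, the tail is bounded by the supremum of `|c k|` over it, so the convergence is
  -- uniform in `a`.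
  have hlim : TendstoUniformlyOn (fun N (a : ℕ → ℝ) => ∑ k ∈ Finset.range N, a k * c k)
      (fun a => ∑' k, a k * c k) atTop {a | (∀ k, 0 ≤ a k) ∧ ∀ s : Finset ℕ, ∑ k ∈ s, a k ≤ 1} := by
    rw [Metric.tendstoUniformlyOn_iff]
    intro ε hε
    obtain ⟨N, hN⟩ := eventually_atTop.mp (Metric.tendsto_nhds.mp hc (ε / 2) (by positivity))
    filter_upwards [eventually_ge_atTop N] with m hm a ha
    have hsa : Summable a := summable_of_sum_le ha.1 ha.2
    obtain ⟨M, hM⟩ := hc.abs.bddAbove_range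
    have hs : Summable fun k => a k * c k := by
      refine Summable.of_norm_bounded (hsa.mul_right M) fun k => ?_
      rw [norm_mul, Real.norm_of_nonneg (ha.1 k)]
      exact mul_le_mul_of_nonneg_left (hM ⟨k, rfl⟩) (ha.1 k)
    rw [Real.dist_eq, ← hs.sum_add_tsum_nat_add m, add_sub_cancel_left]
    have hsa' := (summable_nat_add_iff m).mpr hsa
    have h1 : ‖∑' k, a (k + m) * c (k + m)‖ ≤ ∑' k, a (k + m) * (ε / 2) := by
      refine tsum_of_norm_bounded (hsa'.mul_right _).hasSum fun k => ?_
      rw [norm_mul, Real.norm_of_nonneg (ha.1 _)]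
      refine mul_le_mul_of_nonneg_left ?_ (ha.1 _)
      have := hN (k + m) (by omega)
      rw [dist_zero_right] at this
      exact this.le
    rw [tsum_mul_right] at h1
    have h2 : ∑' k, a (k + m) ≤ 1 := by
      have h3 := hsa.sum_add_tsum_nat_add m
      have h4 : ∑' k, a k ≤ 1 := hsa.tsum_le_of_sum_le ha.2
      have h5 : 0 ≤ ∑ k ∈ Finset.range m, a k := Finset.sum_nonneg fun k _ => ha.1 k
      linarith
    rw [← Real.norm_eq_abs]
    nlinarith
  refine hlim.continuousOn (Eventually.frequently (Eventually.of_forall fun N => ?_))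
  fun_prop

theorem isCompact_subprobability :
    IsCompact {a : ℕ → ℝ | (∀ k, 0 ≤ a k) ∧ ∀ s : Finset ℕ, ∑ k ∈ s, a k ≤ 1} := by
  have h1 : IsCompact (Set.univ.pi fun _ : ℕ => Set.Icc (0 : ℝ) 1) :=
    isCompact_univ_pi fun _ => isCompact_Icc
  refine h1.of_isClosed_subset ?_ fun a ha k _ => ⟨ha.1 k, by simpa using ha.2 {k}⟩
  simp only [Set.ofPred_and, Set.ofPred_forall]
  refine (isClosed_iInter fun k => isClosed_le continuous_const (continuous_apply k)).inter
    (isClosed_iInter fun s => isClosed_le ?_ continuous_const)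
  fun_prop

namespace EllOne

/-- Completing a nonnegative sequence with `∑ a ≤ 1` to an element of the positive face. -/
noncomputable def complete (α : EllOne) (a : ℕ → ℝ) (ha : Summable fun k => |a k|) : EllOne :=
  ofSummable a ha + (1 - ∑' k, a k) • α

theorem complete_mem_positiveFace {α : EllOne} (hα : α ∈ positiveFace) {a : ℕ → ℝ}
    (ha : Summable fun k => |a k|) (h0 : ∀ k, 0 ≤ a k) (h1 : ∑' k, a k ≤ 1) :
    complete α a ha ∈ positiveFace := by
  have h2 : ∀ i, 0 ≤ ofSummable a ha i := h0
  have h3 : ∀ i, 0 ≤ ((1 - ∑' k, a k) • α) i := fun i =>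
    mul_nonneg (sub_nonneg.mpr h1) (hα.1 i)
  refine ⟨fun i => add_nonneg (h2 i) (h3 i), ?_⟩
  rw [complete, norm_add_of_nonneg h2 h3, norm_smul, hα.2,
    Real.norm_of_nonneg (sub_nonneg.mpr h1), norm_eq_tsum_of_nonneg h2]
  simp

theorem complete_self {α g : EllOne} (hg : g ∈ positiveFace) :
    complete α g (summable_abs g) = g := by
  have h : ∑' k, g k = 1 := by rw [← norm_eq_tsum_of_nonneg hg.1, hg.2]
  rw [complete, h, sub_self, zero_smul, add_zero]
  exact ext fun i => rfl

/-- Placing the missing mass at `α` replaces the coefficients `A e_k` by `A e_k - A α`, which form a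
null sequence when `A e_k → A α`. -/
theorem apply_complete (A : EllOne →L[ℝ] ℝ) (α : EllOne) (a : ℕ → ℝ)
    (ha : Summable fun k => |a k|) :
    A (complete α a ha) = ∑' k, a k * (A (basis k) - A α) + A α := by
  have h2 : HasSum (fun k => a k * A (basis k)) (A (ofSummable a ha)) :=
    hasSum_map A (ofSummable a ha)
  have h3 := h2.sub (ha.of_abs.hasSum.mul_right (A α))
  have h4 : ∑' k, a k * (A (basis k) - A α) =
      A (ofSummable a ha) - (∑' k, a k) * A α := by
    rw [← h3.tsum_eq]
    exact tsum_congr fun k => mul_sub _ _ _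
  rw [h4, complete, map_add, map_smul, smul_eq_mul]
  ring

end EllOne

section

variable {X : Type u} [NormedAddCommGroup X] [NormedSpace ℝ X]

/-- Evaluation at a point of the predual, as a functional on `ℓ₁`. -/
noncomputable def evalAt (Φ : StrongDual ℝ X ≃ₗᵢ[ℝ] EllOne) (x : X) : EllOne →L[ℝ] ℝ :=
  (ContinuousLinearMap.apply ℝ ℝ x).comp (Φ.symm : EllOne →L[ℝ] StrongDual ℝ X)

@[simp] theorem evalAt_apply (Φ : StrongDual ℝ X ≃ₗᵢ[ℝ] EllOne) (x : X) (g : EllOne) :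
    evalAt Φ x g = Φ.symm g x := rfl

/-- Mass escaping to infinity reappears at `J α`. Hence `complete` followed by `J` maps the compact
set of subprobability sequences, with the product topology, continuously onto the image of the face.
-/
theorem isCompact_wk_image_positiveFace (Φ : StrongDual ℝ X ≃ₗᵢ[ℝ] EllOne)
    (J : EllOne →ₗᵢ[ℝ] EllOne) {α : EllOne} (hα : α ∈ EllOne.positiveFace)
    (hlim : Tendsto (fun k => wk Φ (J (EllOne.basis k))) atTop (𝓝 (wk Φ (J α)))) :
    IsCompact ((fun g => wk Φ (J g)) '' EllOne.positiveFace) := by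
  set P := {a : ℕ → ℝ | (∀ k, 0 ≤ a k) ∧ ∀ s : Finset ℕ, ∑ k ∈ s, a k ≤ 1} with hP
  have hPs : ∀ a ∈ P, Summable fun k => |a k| := fun a ha => by
    simpa only [abs_of_nonneg (ha.1 _)] using summable_of_sum_le ha.1 ha.2
  have : CompactSpace P := isCompact_iff_compactSpace.mp isCompact_subprobability
  let L : P → WeakDual ℝ X := fun a => wk Φ (J (EllOne.complete α a (hPs a a.2)))
  have hL : Continuous L := by
    refine WeakDual.continuous_of_continuous_eval fun x => ?_
    let A : EllOne →L[ℝ] ℝ := (evalAt Φ x).comp J.toContinuousLinearMap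
    have h0 : Tendsto (fun k => A (EllOne.basis k) - A α) atTop (𝓝 0) := by
      have h1 := ((tendsto_wk_iff Φ).mp hlim x).sub_const (A α)
      rwa [show Φ.symm (J α) x - A α = 0 from sub_self _] at h1
    have h1 := continuousOn_iff_continuous_domRestrict.mp
      ((continuousOn_tsum_mul_of_tendsto_zero h0).add (continuousOn_const (c := A α)))
    exact h1.congr fun a => (EllOne.apply_complete A α a (hPs a a.2)).symm
  have himg : (fun g => wk Φ (J g)) '' EllOne.positiveFace = Set.range L := by
    ext z
    constructor
    · rintro ⟨g, hg, rfl⟩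
      have hg2 : ∑' k, g k = 1 := by rw [← EllOne.norm_eq_tsum_of_nonneg hg.1, hg.2]
      refine ⟨⟨g, hg.1, fun s => ?_⟩, ?_⟩
      · rw [← hg2]; exact (EllOne.summable g).sum_le_tsum s fun i _ => hg.1 i
      · change wk Φ (J (EllOne.complete α g _)) = wk Φ (J g)
        rw [EllOne.complete_self hg]
    · rintro ⟨a, rfl⟩
      exact ⟨_, EllOne.complete_mem_positiveFace hα (hPs a a.2) a.2.1
        ((hPs a a.2).of_abs.tsum_le_of_sum_le a.2.2), rfl⟩
  rw [himg]
  exact isCompact_range hL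

/-- The right shift on the positive face of an isometric copy of `ℓ₁`. -/
theorem not_hasFPP_of_isometry (Φ : StrongDual ℝ X ≃ₗᵢ[ℝ] EllOne)
    (J : EllOne →ₗᵢ[ℝ] EllOne) {α : EllOne} (hα : α ∈ EllOne.positiveFace)
    (hlim : Tendsto (fun k => wk Φ (J (EllOne.basis k))) atTop (𝓝 (wk Φ (J α)))) :
    ¬ HasFPP EllOne (sigmaTopology Φ) := by
  intro hF
  let R : EllOne →L[ℝ] EllOne :=
    EllOne.lift (fun k => EllOne.basis (k + 1)) 1 fun k => (EllOne.norm_basis _).le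
  have hR0 : ∀ g, R g 0 = 0 := by
    intro g
    rw [EllOne.lift_eval]
    simp [EllOne.basis_apply]
  have hRs : ∀ g k, R g (k + 1) = g k := by
    intro g k
    rw [EllOne.lift_eval, tsum_eq_single k]
    · simp [EllOne.basis_apply]
    · intro l hl
      simp [EllOne.basis_apply, hl.symm]
  have hRn : ∀ g, ‖R g‖ = ‖g‖ := by
    intro g
    rw [EllOne.norm_eq, EllOne.norm_eq, (EllOne.summable_abs (R g)).tsum_eq_zero_add]
    simp [hR0, hRs]
  have hRP : ∀ g ∈ EllOne.positiveFace, R g ∈ EllOne.positiveFace := by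
    rintro g ⟨hg, hg1⟩
    refine ⟨?_, by rw [hRn, hg1]⟩
    rintro (_ | k)
    · rw [hR0]
    · rw [hRs]; exact hg k
  have hcomp : @IsCompact EllOne (sigmaTopology Φ) (J '' EllOne.positiveFace) := by
    rw [isCompact_sigma_iff, Set.image_image]
    exact isCompact_wk_image_positiveFace Φ J hα hlim
  have hmem : ∀ z : (J '' EllOne.positiveFace : Set EllOne), ∃ g ∈ EllOne.positiveFace, J g = z :=
    fun z => z.2
  choose p hp hpz using hmem
  obtain ⟨z, hz⟩ := hF (J '' EllOne.positiveFace) ⟨_, _, hα, rfl⟩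
    (EllOne.convex_positiveFace.linear_image J.toLinearMap) hcomp
    (fun z => ⟨J (R (p z)), _, hRP _ (hp z), rfl⟩) (fun z w => by
      change ‖J (R (p z)) - J (R (p w))‖ ≤ _
      rw [← map_sub, ← map_sub, J.norm_map, hRn, ← J.norm_map, map_sub, hpz, hpz])
  have h1 : R (p z) = p z := J.injective (by rw [hpz]; exact congrArg Subtype.val hz)
  -- A sequence fixed by the right shift vanishes coordinate by coordinate, which is impossible at
  -- norm one.
  have h2 : ∀ k, p z k = 0 := by
    intro k
    induction k with
    | zero => rw [← h1, hR0]
    | succ k ih => rw [← h1, hRs, ih]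
  have h3 : p z = 0 := EllOne.ext h2
  have h4 := (hp z).2
  rw [h3, norm_zero] at h4
  exact zero_ne_one h4

end

/-! ### From a fixed-point-free map to a non-compact convex part of the sphere. -/

/-- A nonexpansive self-map of a nonempty bounded closed convex set has approximate fixed
points. -/
theorem exists_norm_sub_map_lt {Z : Type*} [NormedAddCommGroup Z] [NormedSpace ℝ Z]
    [CompleteSpace Z] {C : Set Z} (hne : C.Nonempty) (hconv : Convex ℝ C) (hcl : IsClosed C)
    (hb : Bornology.IsBounded C) {T : Z → Z} (hT : Set.MapsTo T C C)
    (hT1 : ∀ x ∈ C, ∀ y ∈ C, ‖T x - T y‖ ≤ ‖x - y‖) {δ : ℝ} (hδ : 0 < δ) :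
    ∃ x ∈ C, ‖x - T x‖ < δ := by
  obtain ⟨z, hz⟩ := hne
  obtain ⟨M, hM0, hM⟩ := hb.exists_pos_norm_le
  -- The contraction `x ↦ t z + (1 - t) T x` has a fixed point with `x - T x = t (z - T x)`, of norm
  -- at most `t * (2 * M)`.
  obtain ⟨t, ht0, ht1, htM⟩ : ∃ t : ℝ, 0 < t ∧ t < 1 ∧ t * (2 * M) < δ := by
    refine ⟨min (1 / 2) (δ / (4 * M)), by positivity, ?_, ?_⟩
    · exact (min_le_left _ _).trans_lt (by norm_num)
    · calc _ ≤ δ / (4 * M) * (2 * M) := by gcongr; exact min_le_right _ _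
        _ = δ / 2 := by field_simp; norm_num
        _ < δ := by linarith
  have : CompleteSpace C := hcl.completeSpace_coe
  have : Nonempty C := ⟨⟨z, hz⟩⟩
  let S : C → C := fun x => ⟨t • z + (1 - t) • T x,
    hconv hz (hT x.2) ht0.le (by linarith) (by ring)⟩
  have hS : ContractingWith (1 - t).toNNReal S := by
    refine ⟨by simpa using ht0, LipschitzWith.of_dist_le_mul ?_⟩
    intro x y
    rw [Real.coe_toNNReal _ (by linarith)]
    rw [Subtype.dist_eq, Subtype.dist_eq, dist_eq_norm, dist_eq_norm]
    simp only [S, add_sub_add_left_eq_sub, ← smul_sub, norm_smul]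
    rw [Real.norm_of_nonneg (by linarith)]
    exact mul_le_mul_of_nonneg_left (hT1 x x.2 y y.2) (by linarith)
  let x := ContractingWith.fixedPoint S hS
  have hx : t • z + (1 - t) • T x = (x : Z) := congrArg Subtype.val hS.fixedPoint_isFixedPt
  refine ⟨x, x.2, ?_⟩
  have h1 : (x : Z) - T x = t • (z - T x) := by
    nth_rewrite 1 [← hx]
    rw [sub_smul, one_smul, smul_sub]; abel
  rw [h1, norm_smul, Real.norm_of_nonneg ht0.le]
  refine lt_of_le_of_lt ?_ htM
  have := norm_sub_le z (T x)
  have h2 := hM z hz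
  have h3 := hM (T x) (hT x.2)
  gcongr
  linarith

section

variable {X : Type u} [NormedAddCommGroup X] [NormedSpace ℝ X]

theorem isClosed_of_isCompact_wk (Φ : StrongDual ℝ X ≃ₗᵢ[ℝ] EllOne) {C : Set EllOne}
    (hC : IsCompact (wk Φ '' C)) : IsClosed C := by
  have := hC.isClosed.preimage (continuous_wk Φ)
  rwa [Set.preimage_image_eq _ (wk Φ).injective] at this

/-- Weak-star compactness gives pointwise bounds on the complete space `X`; the uniform boundedness
principle does the rest. -/
theorem isBounded_of_isCompact_wk [CompleteSpace X] (Φ : StrongDual ℝ X ≃ₗᵢ[ℝ] EllOne)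
    {C : Set EllOne} (hC : IsCompact (wk Φ '' C)) : Bornology.IsBounded C := by
  have h1 : ∀ x : X, ∃ M, ∀ g : C, ‖Φ.symm g x‖ ≤ M := by
    intro x
    obtain ⟨M, hM⟩ := (hC.image (WeakDual.eval_continuous (𝕜 := ℝ) x)).isBounded.exists_norm_le
    exact ⟨M, fun g => hM _ ⟨_, ⟨g, g.2, rfl⟩, rfl⟩⟩
  obtain ⟨M, hM⟩ := banach_steinhaus h1
  refine isBounded_iff_forall_norm_le.mpr ⟨M, fun g hg => ?_⟩
  simpa using hM ⟨g, hg⟩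

open scoped Pointwise in
/-- Failure of the fixed point property yields a weak-star compact convex subset of the unit sphere
that is not norm compact. -/
theorem exists_noncompact_convex_of_not_hasFPP [CompleteSpace X]
    (Φ : StrongDual ℝ X ≃ₗᵢ[ℝ] EllOne) (h : ¬ HasFPP EllOne (sigmaTopology Φ)) :
    ∃ D : Set EllOne, Convex ℝ D ∧ IsCompact (wk Φ '' D) ∧ (∀ g ∈ D, ‖g‖ = 1) ∧
      ¬ IsCompact D := by
  classical
  unfold HasFPP at h
  push Not at h
  obtain ⟨C, hne, hconv, hcomp, T', hT', hfix'⟩ := h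
  rw [isCompact_sigma_iff] at hcomp
  let T : EllOne → EllOne := fun x => if hx : x ∈ C then T' ⟨x, hx⟩ else x
  have hTe : ∀ x (hx : x ∈ C), T x = T' ⟨x, hx⟩ := fun x hx => dif_pos hx
  have hT : Set.MapsTo T C C := fun x hx => by rw [hTe x hx]; exact (T' _).2
  have hT1 : ∀ x ∈ C, ∀ y ∈ C, ‖T x - T y‖ ≤ ‖x - y‖ := fun x hx y hy => by
    rw [hTe x hx, hTe y hy]; exact hT' _ _
  have hfix : ∀ x ∈ C, T x ≠ x := fun x hx hxx =>
    hfix' ⟨x, hx⟩ (Subtype.ext (by rw [← hTe x hx, hxx]))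
  have hcl := isClosed_of_isCompact_wk Φ hcomp
  have hb := isBounded_of_isCompact_wk Φ hcomp
  obtain ⟨M, hM⟩ := hb.exists_norm_le
  have happ : ∀ n : ℕ, ∃ x ∈ C, ‖x - T x‖ < 1 / ((n : ℝ) + 1) := fun n =>
    exists_norm_sub_map_lt hne hconv hcl hb hT hT1 (by positivity)
  choose x hxC hx using happ
  let U : Ultrafilter ℕ := hyperfilter ℕ
  have hUtop : (U : Filter ℕ) ≤ atTop := Nat.hyperfilter_le_atTop
  obtain ⟨y, -, hy⟩ := EllOne.exists_coordinatewise_limit U (G := x) (M := M)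
    (Eventually.of_forall fun n => hM _ (hxC n))
  have hx0 : Tendsto (fun n => ‖x n - T (x n)‖) U (𝓝 0) :=
    (squeeze_zero (fun _ => norm_nonneg _) (fun n => (hx n).le)
      tendsto_one_div_add_atTop_nhds_zero_nat).mono_left hUtop
  have hlim : ∀ z, Tendsto (fun n => ‖x n - z‖ - ‖x n - y‖) U (𝓝 ‖y - z‖) := by
    intro z
    have h1 := EllOne.tendsto_norm_add_sub_norm (l := (U : Filter ℕ)) (G := fun n => x n - y)
      (fun k => by simpa using (hy k).sub_const (y k)) (y - z)
    simpa using h1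
  -- By `hlim`, distances to `x n` measure distances to `y` up to a term independent of `z`. Because
  -- `x n` is almost fixed, nonexpansiveness of `T` passes to distances from `y`.
  have hTy : ∀ z ∈ C, ‖y - T z‖ ≤ ‖y - z‖ := by
    intro z hz
    have h1 := (hlim z).add hx0
    rw [add_zero] at h1
    refine le_of_tendsto_of_tendsto' (hlim (T z)) h1 fun n => ?_
    have h2 : ‖x n - T z‖ ≤ ‖x n - T (x n)‖ + ‖T (x n) - T z‖ :=
      norm_sub_le_norm_sub_add_norm_sub _ _ _
    have h3 := hT1 _ (hxC n) z hz
    linarith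
  have hyC : y ∉ C := fun hyC => by
    have := hTy y hyC
    rw [sub_self, norm_zero, norm_le_zero_iff, sub_eq_zero] at this
    exact hfix y hyC this.symm
  set ρ := Metric.infDist y C with hρ
  have hρ0 : 0 < ρ := (hcl.notMem_iff_infDist_pos hne).mp hyC
  -- the points of `C` nearest to `y`
  set C₁ := C ∩ Metric.closedBall y ρ with hC₁
  have hC₁n : ∀ z ∈ C₁, ‖z - y‖ = ρ := by
    intro z hz
    refine le_antisymm (by simpa [dist_eq_norm] using hz.2) ?_
    rw [← dist_eq_norm, dist_comm]
    exact Metric.infDist_le_dist_of_mem hz.1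
  have hC₁comp : IsCompact (wk Φ '' C₁) := by
    rw [Set.image_inter (wk Φ).injective]
    exact hcomp.inter (isCompact_wk_closedBall Φ y ρ)
  have hC₁ne : C₁.Nonempty := by
    -- A nested intersection of weak-star compact sets replaces norm compactness in finding a
    -- nearest point.
    have h1 : (⋂ n : ℕ, wk Φ '' (C ∩ Metric.closedBall y (ρ + 1 / ((n : ℝ) + 1)))).Nonempty := by
      refine IsCompact.nonempty_iInter_of_sequence_nonempty_isCompact_isClosed _ (fun n => ?_)
        (fun n => ?_) ?_ fun n => ?_
      · refine Set.image_mono (Set.inter_subset_inter_right _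
          (Metric.closedBall_subset_closedBall ?_))
        gcongr
        simp
      · obtain ⟨z, hz, hzd⟩ := (Metric.infDist_lt_iff hne).mp
          (show Metric.infDist y C < ρ + 1 / ((n : ℝ) + 1) by
            have : (0 : ℝ) < 1 / ((n : ℝ) + 1) := by positivity
            linarith)
        exact ⟨_, z, ⟨hz, by rw [Metric.mem_closedBall, dist_comm]; exact hzd.le⟩, rfl⟩
      · rw [Set.image_inter (wk Φ).injective]
        exact hcomp.inter (isCompact_wk_closedBall Φ y _)
      · rw [Set.image_inter (wk Φ).injective]
        exact (hcomp.inter (isCompact_wk_closedBall Φ y _)).isClosed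
    obtain ⟨w, hw⟩ := h1
    simp only [Set.mem_iInter] at hw
    obtain ⟨z, hz, rfl⟩ := hw 0
    refine ⟨z, hz.1, ?_⟩
    have h2 : ∀ n : ℕ, dist z y ≤ ρ + 1 / ((n : ℝ) + 1) := fun n => by
      obtain ⟨z', hz', hzz⟩ := hw n
      rw [← (wk Φ).injective hzz]
      exact hz'.2
    have h3 := (tendsto_const_nhds (x := ρ)).add
      (tendsto_one_div_add_atTop_nhds_zero_nat (𝕜 := ℝ))
    rw [add_zero] at h3
    exact ge_of_tendsto' h3 h2
  have hC₁conv : Convex ℝ C₁ := hconv.inter (convex_closedBall y ρ)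
  have hTC₁ : Set.MapsTo T C₁ C₁ := fun z hz => ⟨hT hz.1, by
    have := hTy z hz.1
    rw [norm_sub_rev y, norm_sub_rev y, hC₁n z hz] at this
    simpa [dist_eq_norm] using this⟩
  let A : EllOne → EllOne := fun z => ρ⁻¹ • (z - y)
  refine ⟨A '' C₁, ?_, ?_, ?_, ?_⟩
  · have h1 : A '' C₁ = ρ⁻¹ • ((fun z => -y + z) '' C₁) := by
      rw [← Set.image_smul, Set.image_image]
      exact Set.image_congr fun z _ => by simp [A, sub_eq_neg_add]
    rw [h1]
    exact (hC₁conv.translate (-y)).smul ρ⁻¹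
  · have h1 : wk Φ '' (A '' C₁) = (fun w => ρ⁻¹ • (w - wk Φ y)) '' (wk Φ '' C₁) := by
      rw [Set.image_image, Set.image_image]
      exact Set.image_congr fun z _ => by simp [A]
    rw [h1]
    exact hC₁comp.image (by fun_prop)
  · rintro _ ⟨z, hz, rfl⟩
    simp only [A]
    rw [norm_smul, hC₁n z hz, norm_inv, Real.norm_of_nonneg hρ0.le, inv_mul_cancel₀ hρ0.ne']
  -- Norm compactness would make the displacement `‖z - T z‖` attain its minimum on the invariant
  -- set `C₁`, positive because there is no fixed point, whereas approximate fixed points make it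
  -- arbitrarily small.
  · intro hD
    have hC₁c : IsCompact C₁ := by
      have h1 : C₁ = (fun w => ρ • w + y) '' (A '' C₁) := by
        rw [Set.image_image]
        simp [A, smul_smul, mul_inv_cancel₀ hρ0.ne']
      rw [h1]
      exact hD.image (by fun_prop)
    have hcont : ContinuousOn (fun z => ‖z - T z‖) C₁ := by
      have hTc : ContinuousOn T C₁ := by
        refine (LipschitzOnWith.of_dist_le_mul (K := 1) fun a ha b hb => ?_).continuousOn
        rw [dist_eq_norm, dist_eq_norm, NNReal.coe_one, one_mul]
        exact hT1 a ha.1 b hb.1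
      exact (continuousOn_id.sub hTc).norm
    obtain ⟨z, hz, hzmin⟩ := hC₁c.exists_isMinOn hC₁ne hcont
    have hzpos : 0 < ‖z - T z‖ :=
      norm_pos_iff.mpr (sub_ne_zero.mpr fun h => hfix z hz.1 h.symm)
    obtain ⟨w, hw, hwlt⟩ := exists_norm_sub_map_lt hC₁ne hC₁conv hC₁c.isClosed hC₁c.isBounded hTC₁
      (fun a ha b hb => hT1 a ha.1 b hb.1) hzpos
    exact absurd (hzmin hw) (not_le.mpr hwlt)

end

/-! ### Extreme points of a Choquet simplex. -/

section Cone

variable {E : Type*} [AddCommGroup E] [Module ℝ E] {S : Set E}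

theorem smul_mem_coneOver {t : ℝ} (ht : 0 ≤ t) {s : E} (hs : s ∈ S) :
    t • (s, (1 : ℝ)) ∈ coneOver S :=
  ⟨t, ht, s, hs, by simp⟩

theorem exists_smul_eq_of_mem_coneOver {x : E × ℝ} (hx : x ∈ coneOver S) :
    0 ≤ x.2 ∧ ∃ s ∈ S, x = x.2 • (s, (1 : ℝ)) := by
  obtain ⟨t, ht, s, hs, rfl⟩ := hx
  exact ⟨ht, s, hs, by simp⟩

theorem add_mem_coneOver (hS : Convex ℝ S) {x y : E × ℝ} (hx : x ∈ coneOver S)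
    (hy : y ∈ coneOver S) : x + y ∈ coneOver S := by
  obtain ⟨a, ha, s, hs, rfl⟩ := hx
  obtain ⟨b, hb, t, ht, rfl⟩ := hy
  rcases (add_nonneg ha hb).eq_or_lt with h | h
  · have ha0 : a = 0 := by linarith
    have hb0 : b = 0 := by linarith
    exact ⟨0, le_rfl, s, hs, by simp [ha0, hb0]⟩
  · refine ⟨a + b, h.le, (a / (a + b)) • s + (b / (a + b)) • t,
      hS hs ht (by positivity) (by positivity) (by field_simp), ?_⟩
    simp only [Prod.mk_add_mk, smul_add, smul_smul]
    rw [mul_div_cancel₀ _ h.ne', mul_div_cancel₀ _ h.ne']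

theorem convex_coneOver (hS : Convex ℝ S) : Convex ℝ (coneOver S) := by
  have hsmul : ∀ x ∈ coneOver S, ∀ c : ℝ, 0 ≤ c → c • x ∈ coneOver S := by
    rintro _ ⟨t, ht, s, hs, rfl⟩ c hc
    exact ⟨c * t, mul_nonneg hc ht, s, hs, by simp [mul_smul]⟩
  intro x hx y hy a b ha hb _
  exact add_mem_coneOver hS (hsmul x hx a ha) (hsmul y hy b hb)

/-- Two distinct extreme points of a simplex are disjoint in the order of the cone. -/
theorem ChoquetSimplex.one_le_of_sub_eq [TopologicalSpace E] (S : ChoquetSimplex E) {s t : E}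
    (hs : s ∈ S.carrier.extremePoints ℝ) (ht : t ∈ S.carrier.extremePoints ℝ) (hst : s ≠ t)
    {x y : E × ℝ} (hx : x ∈ coneOver S.carrier) (hy : y ∈ coneOver S.carrier)
    (h : (s, (1 : ℝ)) - (t, (1 : ℝ)) = x - y) : 1 ≤ x.2 := by
  have hs' : (s, (1 : ℝ)) ∈ coneOver S.carrier := ⟨1, zero_le_one, s, hs.1, by simp⟩
  have ht' : (t, (1 : ℝ)) ∈ coneOver S.carrier := ⟨1, zero_le_one, t, ht.1, by simp⟩
  obtain ⟨z, hz, hzs, hzt, hzmin⟩ := S.exists_sup _ hs' _ ht'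
  -- an element of the cone below an extreme generator is a multiple of it
  have key : ∀ e ∈ S.carrier.extremePoints ℝ, ∀ r ∈ coneOver S.carrier,
      (e, (1 : ℝ)) - r ∈ coneOver S.carrier → r = r.2 • (e, (1 : ℝ)) := by
    intro e he r hr hre
    obtain ⟨hr0, p, hp, hrp⟩ := exists_smul_eq_of_mem_coneOver hr
    obtain ⟨hr1, q, hq, hrq⟩ := exists_smul_eq_of_mem_coneOver hre
    simp only [Prod.snd_sub] at hr1 hrq
    have h1 : r.1 = r.2 • p := by simpa using congrArg Prod.fst hrp
    have h2 : e - r.1 = (1 - r.2) • q := by simpa using congrArg Prod.fst hrq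
    have he2 : r.2 • p + (1 - r.2) • q = e := by rw [← h1, ← h2]; abel
    rcases hr0.eq_or_lt with h0 | h0
    · rw [hrp, ← h0, zero_smul, Prod.snd_zero, zero_smul]
    · rcases hr1.eq_or_lt with h3 | h3
      · have h4 : r.2 = 1 := by linarith
        rw [h4, sub_self, zero_smul, add_zero, one_smul] at he2
        rw [hrp, he2]; simp
      · have h5 : p = e := he.2 hp hq ⟨r.2, 1 - r.2, h0, h3, by ring, he2⟩
        nth_rewrite 1 [hrp]
        rw [h5]
  -- Here `s + t - z` lies below both `s` and `t`, so it is a multiple of each generator and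
  -- vanishes: the supremum is `s + t`.
  have hub : (s, (1 : ℝ)) + (t, (1 : ℝ)) - z ∈ coneOver S.carrier :=
    hzmin _ (add_mem_coneOver S.convex hs' ht') (by simpa using ht') (by simpa using hs')
  set r := (s, (1 : ℝ)) + (t, (1 : ℝ)) - z with hr
  have hrs := key s hs r hub (by
    have : (s, (1 : ℝ)) - r = z - (t, (1 : ℝ)) := by rw [hr]; abel
    rwa [this])
  have hrt := key t ht r hub (by
    have : (t, (1 : ℝ)) - r = z - (s, (1 : ℝ)) := by rw [hr]; abel
    rwa [this])
  have hr0 : r = 0 := by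
    by_cases h0 : r.2 = 0
    · rw [hrs, h0, zero_smul]
    · refine absurd ?_ hst
      have h1 : r.2 • s = r.2 • t := by
        simpa using congrArg Prod.fst (hrs.symm.trans hrt)
      exact smul_right_injective E h0 h1
  have hz' : z = (s, (1 : ℝ)) + (t, (1 : ℝ)) := (sub_eq_zero.mp (hr ▸ hr0)).symm
  -- The element `t + x = s + y` is an upper bound, hence dominates `s + t`; comparing heights gives
  -- `1 ≤ x.2`.
  have hw : (t, (1 : ℝ)) + x - z ∈ coneOver S.carrier := by
    refine hzmin _ (add_mem_coneOver S.convex ht' hx) ?_ (by simpa using hx)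
    have : (t, (1 : ℝ)) + x - (s, 1) = y := by
      have h2 : x = (s, (1 : ℝ)) - (t, (1 : ℝ)) + y := by rw [h]; abel
      rw [h2]; abel
    rwa [this]
  have h3 := (exists_smul_eq_of_mem_coneOver hw).1
  rw [hz'] at h3
  simp only [Prod.snd_sub, Prod.snd_add] at h3
  linarith

end Cone

section Simplex

variable {E : Type*} [AddCommGroup E] [Module ℝ E] [TopologicalSpace E]
  [IsTopologicalAddGroup E] [ContinuousSMul ℝ E] [LocallyConvexSpace ℝ E] [T2Space E]

-- With `P` the part of the cone of height at most `1/2`, `s - t` avoids the compact convex set `P -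
-- P`, because any difference representing it starts from height at least one. A separating
-- functional below `c` on `P - P` has size at most `2c` on `S`, and exceeds `c` at `s - t`.
open scoped Pointwise in
theorem ChoquetSimplex.exists_affine_separating (S : ChoquetSimplex E) {s t : S.carrier}
    (hs : (s : E) ∈ S.carrier.extremePoints ℝ) (ht : (t : E) ∈ S.carrier.extremePoints ℝ)
    (hst : s ≠ t) :
    ∃ φ : affineFunctions S, ‖φ‖ / 2 < (φ : C(S.carrier, ℝ)) s - (φ : C(S.carrier, ℝ)) t := by
  set P : Set (E × ℝ) := (fun p : ℝ × E => p.1 • (p.2, (1 : ℝ))) ''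
    (Set.Icc (0 : ℝ) (1 / 2) ×ˢ S.carrier) with hP
  have hPcone : P = coneOver S.carrier ∩ {x | x.2 ≤ 1 / 2} := by
    ext x
    constructor
    · rintro ⟨⟨a, p⟩, ⟨ha, hp⟩, rfl⟩
      exact ⟨smul_mem_coneOver ha.1 hp, by simpa using ha.2⟩
    · rintro ⟨hx, hx2⟩
      obtain ⟨h0, p, hp, h⟩ := exists_smul_eq_of_mem_coneOver hx
      exact ⟨(x.2, p), ⟨⟨h0, hx2⟩, hp⟩, h.symm⟩
  have hPconv : Convex ℝ P := by
    rw [hPcone]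
    exact (convex_coneOver S.convex).inter
      (convex_halfSpace_le (LinearMap.snd ℝ E ℝ).isLinear (1 / 2))
  have hPcomp : IsCompact P :=
    (isCompact_Icc.prod S.isCompact).image (by fun_prop)
  have hPPcomp : IsCompact (P - P) := by
    rw [← Set.sub_image_prod]
    exact (hPcomp.prod hPcomp).image continuous_sub
  have hnot : ((s : E), (1 : ℝ)) - ((t : E), (1 : ℝ)) ∉ P - P := by
    rintro ⟨x, hx, y, hy, hxy⟩
    rw [hPcone] at hx hy
    have := S.one_le_of_sub_eq hs ht (fun h => hst (Subtype.ext h)) hx.1 hy.1 hxy.symm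
    have h2 : x.2 ≤ 1 / 2 := hx.2
    linarith
  obtain ⟨f, c, hf, hc⟩ := geometric_hahn_banach_closed_point (hPconv.sub hPconv)
    hPPcomp.isClosed hnot
  have h0 : (0 : E × ℝ) ∈ P := ⟨(0, s), ⟨by simp, s.2⟩, by simp⟩
  have hbd : ∀ p : S.carrier, |f ((p : E), (1 : ℝ))| ≤ 2 * c := by
    intro p
    have hp : (1 / 2 : ℝ) • ((p : E), (1 : ℝ)) ∈ P := ⟨(1 / 2, p), ⟨by norm_num, p.2⟩, rfl⟩
    have h1 := hf _ (Set.sub_mem_sub hp h0)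
    have h2 := hf _ (Set.sub_mem_sub h0 hp)
    simp only [sub_zero, zero_sub, map_neg, map_smul, smul_eq_mul] at h1 h2
    rw [abs_le]
    constructor <;> linarith
  let φ : affineFunctions S := ⟨⟨fun p => f ((p : E), (1 : ℝ)), by fun_prop⟩, by
    intro x y z a b ha hb hab hz
    change f ((z : E), (1 : ℝ)) = a * f ((x : E), (1 : ℝ)) + b * f ((y : E), (1 : ℝ))
    rw [← smul_eq_mul, ← smul_eq_mul, ← map_smul, ← map_smul, ← map_add, hz]
    simp [hab]⟩
  have hφ : ‖φ‖ ≤ 2 * c := by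
    refine (ContinuousMap.norm_le _ ?_).mpr hbd
    exact (abs_nonneg _).trans (hbd s)
  refine ⟨φ, ?_⟩
  change ‖φ‖ / 2 < f ((s : E), (1 : ℝ)) - f ((t : E), (1 : ℝ))
  rw [← map_sub]
  linarith

/-- The zero set of an affine continuous function is closed and convex, so by Krein–Milman
restriction to the extreme points is injective on `A(S)`. -/
theorem ChoquetSimplex.infinite_extremePoints (S : ChoquetSimplex E)
    (h : ¬ FiniteDimensional ℝ (affineFunctions S)) :
    (S.carrier.extremePoints ℝ).Infinite := by
  intro hfin
  apply h
  have : Finite (S.carrier.extremePoints ℝ) := hfin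
  let L : affineFunctions S →ₗ[ℝ] (S.carrier.extremePoints ℝ → ℝ) :=
    { toFun := fun φ e => (φ : C(S.carrier, ℝ)) ⟨e, extremePoints_subset e.2⟩
      map_add' := fun _ _ => rfl
      map_smul' := fun _ _ => rfl }
  refine FiniteDimensional.of_injective L ?_
  rw [injective_iff_map_eq_zero]
  intro φ hφ
  set N : Set E := Subtype.val '' {p : S.carrier | (φ : C(S.carrier, ℝ)) p = 0} with hN
  have hNc : IsClosed N := by
    have h1 : IsClosed {p : S.carrier | (φ : C(S.carrier, ℝ)) p = 0} :=
      isClosed_eq (map_continuous _) continuous_const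
    exact (h1.isCompact.image continuous_subtype_val).isClosed
  have hNconv : Convex ℝ N := by
    rintro _ ⟨p, hp, rfl⟩ _ ⟨q, hq, rfl⟩ a b ha hb hab
    refine ⟨⟨_, S.convex p.2 q.2 ha hb hab⟩, ?_, rfl⟩
    have := φ.2 p q ⟨_, S.convex p.2 q.2 ha hb hab⟩ a b ha hb hab rfl
    simp only [Set.mem_ofPred_eq] at hp hq ⊢
    rw [this, hp, hq]; ring
  have hsub : S.carrier ⊆ N := by
    rw [← closure_convexHull_extremePoints S.isCompact S.convex]
    refine closure_minimal (convexHull_min ?_ hNconv) hNc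
    intro e he
    exact ⟨⟨e, extremePoints_subset he⟩, congrFun hφ ⟨e, he⟩, rfl⟩
  refine Subtype.ext (ContinuousMap.ext fun p => ?_)
  obtain ⟨q, hq, hqp⟩ := hsub p.2
  rw [← Subtype.ext hqp]
  exact hq

end Simplex

/-! ### States on a quotient of the predual. -/

section

variable {X : Type u} [NormedAddCommGroup X] [NormedSpace ℝ X]

theorem LinearIsometry.injective_of_norm_eq_zero {A B : Type*} [SeminormedAddCommGroup A]
    [SeminormedAddCommGroup B] [Module ℝ A] [Module ℝ B] (ι : A →ₗᵢ[ℝ] B)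
    (h : ∀ a : A, ‖a‖ = 0 → a = 0) : Function.Injective ι := by
  refine (injective_iff_map_eq_zero ι).mpr fun a ha => h a ?_
  rw [← ι.norm_map, ha, norm_zero]

/-- The norm-one functionals on the quotient that extend a given functional of a subspace. -/
theorem exists_lift_of_functional (Φ : StrongDual ℝ X ≃ₗᵢ[ℝ] EllOne) (Y : Submodule ℝ X)
    {A : Type*} [SeminormedAddCommGroup A] [Module ℝ A] (ι : A →ₗᵢ[ℝ] (X ⧸ Y))
    (hι : Function.Injective ι) (δ : A →ₗ[ℝ] ℝ) (hδ : ∀ φ, |δ φ| ≤ ‖φ‖) :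
    ∃ g : EllOne, ‖g‖ ≤ 1 ∧ ∀ φ x, Y.mkQ x = ι φ → Φ.symm g x = δ φ := by
  let e := LinearEquiv.ofInjective ι.toLinearMap hι
  let f : StrongDual ℝ (LinearMap.range ι.toLinearMap) :=
    LinearMap.mkContinuous (δ.comp e.symm.toLinearMap) 1 (by
      intro z
      obtain ⟨φ, rfl⟩ := e.surjective z
      have h1 : ‖e φ‖ = ‖φ‖ := ι.norm_map φ
      simpa [h1] using hδ φ)
  have hf1 : ‖f‖ ≤ 1 := LinearMap.mkContinuous_norm_le _ zero_le_one _
  obtain ⟨G, hG, hGn⟩ := exists_extension_norm_eq _ f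
  refine ⟨Φ (G.comp Y.mkQL), ?_, ?_⟩
  · rw [Φ.norm_map]
    refine ContinuousLinearMap.opNorm_le_bound _ zero_le_one fun x => ?_
    calc ‖G (Y.mkQ x)‖ ≤ ‖G‖ * ‖Y.mkQ x‖ := G.le_opNorm _
      _ ≤ 1 * ‖x‖ := by
        gcongr
        · rw [hGn]; exact hf1
        · exact Submodule.Quotient.norm_mk_le Y x
  · intro φ x hx
    rw [Φ.symm_apply_apply]
    change G (Y.mkQ x) = δ φ
    rw [hx]
    have h1 := hG (e φ)
    have h2 : f (e φ) = δ φ := by simp [f]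
    rw [h2] at h1
    exact h1

/-- If a quotient of the predual contains an infinite family of uniformly separated "states", then
the corresponding face of the unit sphere of `ℓ₁` is weak-star compact but not norm compact. -/
theorem exists_noncompact_convex_of_states (Φ : StrongDual ℝ X ≃ₗᵢ[ℝ] EllOne)
    (Y : Submodule ℝ X) {A : Type*} [SeminormedAddCommGroup A] [Module ℝ A]
    (ι : A →ₗᵢ[ℝ] (X ⧸ Y)) (hι : Function.Injective ι) {one : A} (hone : ‖one‖ ≤ 1)
    (δ : ℕ → A →ₗ[ℝ] ℝ) (hδ : ∀ n φ, |δ n φ| ≤ ‖φ‖) (hδ1 : ∀ n, δ n one = 1)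
    (hδsep : ∀ n m, n ≠ m → ∃ φ, ‖φ‖ / 2 < δ n φ - δ m φ) :
    ∃ D : Set EllOne, Convex ℝ D ∧ IsCompact (wk Φ '' D) ∧ (∀ g ∈ D, ‖g‖ = 1) ∧
      ¬ IsCompact D := by
  obtain ⟨x₀, hx₀⟩ := Y.mkQ_surjective (ι one)
  set D : Set EllOne := {g | (∀ y ∈ Y, Φ.symm g y = 0) ∧ ‖g‖ ≤ 1 ∧ Φ.symm g x₀ = 1} with hD
  refine ⟨D, ?_, ?_, ?_, ?_⟩
  · rintro f ⟨hf1, hf2, hf3⟩ g ⟨hg1, hg2, hg3⟩ a b ha hb hab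
    refine ⟨fun y hy => by simp [hf1 y hy, hg1 y hy], ?_, by simp [hf3, hg3, hab]⟩
    have := convex_closedBall (0 : EllOne) 1 (by simpa using hf2) (by simpa using hg2) ha hb hab
    simpa using this
  · have h1 : wk Φ '' D = wk Φ '' Metric.closedBall (0 : EllOne) 1 ∩
        ((⋂ y ∈ Y, {z : WeakDual ℝ X | z y = 0}) ∩ {z | z x₀ = 1}) := by
      ext z
      obtain ⟨g, rfl⟩ := (wk Φ).surjective z
      simp [hD, and_left_comm]
    rw [h1]
    refine (isCompact_wk_closedBall Φ 0 1).inter_right (IsClosed.inter ?_ ?_)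
    · exact isClosed_biInter fun y _ => isClosed_eq (WeakDual.eval_continuous y) continuous_const
    · exact isClosed_eq (WeakDual.eval_continuous x₀) continuous_const
  · rintro g ⟨hg1, hg2, hg3⟩
    refine le_antisymm hg2 ?_
    refine le_of_forall_pos_le_add fun η hη => ?_
    -- A representative of `one` of norm below `1 + η`, on which `g` still takes the value one,
    -- bounds `‖g‖` from below.
    obtain ⟨m, hm, hmn⟩ := Submodule.Quotient.norm_mk_lt (ι one) hη
    rw [ι.norm_map] at hmn
    have h1 : Φ.symm g m = 1 := by
      have h2 : m - x₀ ∈ Y := by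
        rw [← Submodule.Quotient.mk_eq_zero, Submodule.Quotient.mk_sub, hm, sub_eq_zero]
        exact hx₀.symm
      have h3 := hg1 _ h2
      rw [map_sub, hg3] at h3
      linarith
    have h2 := abs_symm_apply_le Φ g m
    rw [h1, abs_one] at h2
    nlinarith [norm_nonneg g]
  · intro hDc
    have hlift : ∀ n, ∃ g : EllOne, ‖g‖ ≤ 1 ∧ ∀ φ x, Y.mkQ x = ι φ → Φ.symm g x = δ n φ := fun n =>
      exists_lift_of_functional Φ Y ι hι (δ n) (hδ n)
    choose g hg1 hg2 using hlift
    have hgD : ∀ n, g n ∈ D := fun n => ⟨fun y hy => by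
      rw [hg2 n 0 y (by simpa using hy), map_zero], hg1 n, by rw [hg2 n one x₀ hx₀, hδ1]⟩
    have hsep : ∀ n m, n ≠ m → 1 / 2 ≤ dist (g n) (g m) := by
      intro n m hnm
      obtain ⟨φ, hφ⟩ := hδsep n m hnm
      have hφ0 : 0 < ‖φ‖ := by
        refine lt_of_le_of_ne (norm_nonneg φ) fun h0 => ?_
        have h1 := hδ n φ
        have h2 := hδ m φ
        rw [← h0] at h1 h2 hφ
        rw [abs_nonpos_iff] at h1 h2
        simp [h1, h2] at hφ
      rw [dist_eq_norm]
      refine le_of_forall_pos_le_add fun η hη => ?_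
      -- Since `‖g n - g m‖ ≤ 2`, the excess `η * ‖φ‖ / 2` costs at most `η * ‖φ‖`, which leaves `η`
      -- after division by `‖φ‖`.
      obtain ⟨x, hx, hxn⟩ := Submodule.Quotient.norm_mk_lt (ι φ)
        (show 0 < η * ‖φ‖ / 2 by positivity)
      rw [ι.norm_map] at hxn
      have h1 := abs_symm_apply_le Φ (g n - g m) x
      have h2 : Φ.symm (g n - g m) x = δ n φ - δ m φ := by
        rw [map_sub, ← hg2 n φ x hx, ← hg2 m φ x hx]; rfl
      have h3 : ‖φ‖ / 2 < δ n φ - δ m φ := hφ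
      have h4 : ‖g n - g m‖ ≤ 2 := (norm_sub_le _ _).trans (by linarith [hg1 n, hg1 m])
      rw [h2] at h1
      have h5 : ‖φ‖ / 2 < ‖g n - g m‖ * ‖x‖ := (h3.trans_le (le_abs_self _)).trans_le h1
      have h6 : ‖g n - g m‖ * ‖x‖ ≤ ‖g n - g m‖ * ‖φ‖ + η * ‖φ‖ := by
        nlinarith [norm_nonneg (g n - g m), mul_pos hη hφ0]
      nlinarith
    obtain ⟨a, -, ψ, hψ, hlim⟩ := hDc.tendsto_subseq hgD
    have hc := Metric.cauchySeq_iff'.mp hlim.cauchySeq (1 / 2) (by norm_num)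
    obtain ⟨N, hN⟩ := hc
    have h1 := hN (N + 1) (by omega)
    exact absurd h1 (not_lt.mpr (hsep _ _ (hψ (Nat.lt_succ_self N)).ne'))

/-- The states are evaluations at infinitely many distinct extreme points, normalized at the
constant function one. -/
theorem exists_noncompact_convex_of_simplex (Φ : StrongDual ℝ X ≃ₗᵢ[ℝ] EllOne)
    (Y : Submodule ℝ X) {E : Type*} [AddCommGroup E] [Module ℝ E] [TopologicalSpace E]
    [IsTopologicalAddGroup E] [ContinuousSMul ℝ E] [LocallyConvexSpace ℝ E] [T2Space E]
    (S : ChoquetSimplex E)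
    (hinf : ¬ FiniteDimensional ℝ (affineFunctions S)) (ι : affineFunctions S →ₗᵢ[ℝ] (X ⧸ Y)) :
    ∃ D : Set EllOne, Convex ℝ D ∧ IsCompact (wk Φ '' D) ∧ (∀ g ∈ D, ‖g‖ = 1) ∧
      ¬ IsCompact D := by
  let one : affineFunctions S := ⟨1, fun x y z a b _ _ hab _ => by simp [hab]⟩
  have hone : ‖one‖ ≤ 1 := (ContinuousMap.norm_le _ zero_le_one).mpr fun p => by simp [one]
  have hι : Function.Injective ι := LinearIsometry.injective_of_norm_eq_zero ι fun φ h =>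
    Subtype.ext (norm_eq_zero.mp (show ‖(φ : C(S.carrier, ℝ))‖ = 0 from h))
  have hext := S.infinite_extremePoints hinf
  let e : ℕ ↪ S.carrier.extremePoints ℝ := hext.natEmbedding
  let p : ℕ → S.carrier := fun n => ⟨e n, extremePoints_subset (e n).2⟩
  have hp : ∀ n m, n ≠ m → p n ≠ p m := fun n m hnm h => by
    have h' : (p n : E) = p m := congrArg Subtype.val h
    exact hnm (e.injective (Subtype.ext h'))
  let δ : ℕ → affineFunctions S →ₗ[ℝ] ℝ := fun n =>
    { toFun := fun φ => (φ : C(S.carrier, ℝ)) (p n)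
      map_add' := fun _ _ => rfl
      map_smul' := fun _ _ => rfl }
  have hδ : ∀ n φ, |δ n φ| ≤ ‖φ‖ := fun n φ => (φ : C(S.carrier, ℝ)).norm_coe_le_norm (p n)
  exact exists_noncompact_convex_of_states Φ Y ι hι hone δ hδ (fun _ => rfl) fun n m hnm =>
    S.exists_affine_separating (e n).2 (e m).2 (hp n m hnm)

end

/-! ### Simplices arising from the positive face. -/

section PositiveCone

namespace EllOne

theorem inv_norm_smul_mem_positiveFace {a : EllOne} (ha : ∀ i, 0 ≤ a i) (h : 0 < ‖a‖) :
    ‖a‖⁻¹ • a ∈ positiveFace := by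
  refine ⟨fun i => mul_nonneg (by positivity) (ha i), ?_⟩
  rw [norm_smul, norm_inv, norm_norm, inv_mul_cancel₀ h.ne']

/-- The pointwise supremum of two elements of `ℓ₁`. -/
noncomputable def sup (a b : EllOne) : EllOne :=
  ofSummable (fun i => max (a i) (b i))
    (((summable_abs a).add (summable_abs b)).of_nonneg_of_le (fun _ => abs_nonneg _) fun i => by
      rcases max_cases (a i) (b i) with h | h <;> rw [h.1]
      · exact le_add_of_nonneg_right (abs_nonneg _)
      · exact le_add_of_nonneg_left (abs_nonneg _))

/-- The sum of the coordinates. -/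
noncomputable def coordSum : EllOne →L[ℝ] ℝ := lift (fun _ => (1 : ℝ)) 1 fun _ => by simp

theorem coordSum_of_nonneg {a : EllOne} (ha : ∀ i, 0 ≤ a i) : coordSum a = ‖a‖ := by
  rw [norm_eq_tsum_of_nonneg ha, coordSum, lift_apply]
  simp

/-- A bounded additive function on the positive cone of `ℓ₁` is given by its values on the
basis. -/
theorem hasSum_of_additive {Ψ : EllOne → ℝ} {M : ℝ}
    (hadd : ∀ a b : EllOne, (∀ i, 0 ≤ a i) → (∀ i, 0 ≤ b i) → Ψ (a + b) = Ψ a + Ψ b)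
    (hM : ∀ a : EllOne, |Ψ a| ≤ M * ‖a‖) {a : EllOne} (ha : ∀ i, 0 ≤ a i) :
    Tendsto (fun N => ∑ k ∈ Finset.range N, Ψ (a k • basis k)) atTop (𝓝 (Ψ a)) := by
  have hb : ∀ k i, 0 ≤ (a k • basis k) i := fun k i =>
    mul_nonneg (ha k) ((basis_mem_positiveFace k).1 i)
  have hsum : ∀ N i, 0 ≤ (∑ k ∈ Finset.range N, a k • basis k) i := by
    intro N i
    rw [lp.coeFn_sum, Finset.sum_apply]
    exact Finset.sum_nonneg fun k _ => hb k i
  have h0 : Ψ 0 = 0 := by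
    have := hM 0
    rwa [norm_zero, mul_zero, abs_nonpos_iff] at this
  have h1 : ∀ N, Ψ (∑ k ∈ Finset.range N, a k • basis k) =
      ∑ k ∈ Finset.range N, Ψ (a k • basis k) := by
    intro N
    induction N with
    | zero => simp [h0]
    | succ N ih => rw [Finset.sum_range_succ, Finset.sum_range_succ, hadd _ _ (hsum N) (hb N), ih]
  have htail : ∀ N i, 0 ≤ (a - ∑ k ∈ Finset.range N, a k • basis k) i := by
    intro N i
    have h2 : (∑ k ∈ Finset.range N, a k • basis k) i = if i < N then a i else 0 := by
      rw [lp.coeFn_sum, Finset.sum_apply]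
      have h3 : ∀ k, (a k • basis k) i = if i = k then a k else 0 := by
        intro k
        change a k * basis k i = _
        rw [basis_apply]; split_ifs <;> simp
      simp_rw [h3]
      rw [Finset.sum_ite_eq]
      simp
    change 0 ≤ a i - (∑ k ∈ Finset.range N, a k • basis k) i
    rw [h2]
    split_ifs
    · simp
    · simpa using ha i
  have h2 : ∀ N, Ψ a - ∑ k ∈ Finset.range N, Ψ (a k • basis k) =
      Ψ (a - ∑ k ∈ Finset.range N, a k • basis k) := by
    intro N
    have h3 := hadd _ _ (hsum N) (htail N)
    rw [add_sub_cancel] at h3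
    rw [h3, h1]; ring
  -- The remainder is `Ψ` of the tail of `a`, again in the positive cone, whose norm tends to zero.
  have h3 : Tendsto (fun N => Ψ a - ∑ k ∈ Finset.range N, Ψ (a k • basis k)) atTop (𝓝 0) := by
    simp_rw [h2]
    refine squeeze_zero_norm (fun N => hM _) ?_
    have h4 := ((tendsto_const_nhds (x := a)).sub (hasSum_basis a).tendsto_sum_nat).norm.const_mul M
    simpa using h4
  simpa using (tendsto_const_nhds (x := Ψ a)).sub h3

end EllOne

end PositiveCone

section SimplexOfEllOne

variable {E : Type*} [AddCommGroup E] [Module ℝ E]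

/-- On the positive orthant `coordSum` is the norm, hence the height in the cone. For injective `κ`
the cone order is therefore the coordinatewise order, where suprema are explicit. -/
theorem mem_coneOver_image_positiveFace (κ : EllOne →ₗ[ℝ] E) (x : E × ℝ) :
    x ∈ coneOver (κ '' EllOne.positiveFace) ↔
      ∃ a : EllOne, (∀ i, 0 ≤ a i) ∧ x = (κ a, EllOne.coordSum a) := by
  constructor
  · rintro ⟨t, ht, _, ⟨g, hg, rfl⟩, rfl⟩
    refine ⟨t • g, fun i => mul_nonneg ht (hg.1 i), ?_⟩
    rw [map_smul, map_smul, EllOne.coordSum_of_nonneg hg.1, hg.2, smul_eq_mul, mul_one]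
  · rintro ⟨a, ha, rfl⟩
    rw [EllOne.coordSum_of_nonneg ha]
    rcases (norm_nonneg a).eq_or_lt with h | h
    · rw [norm_eq_zero.mp h.symm]
      exact ⟨0, le_rfl, _, ⟨_, EllOne.basis_mem_positiveFace 0, rfl⟩, by simp⟩
    · refine ⟨‖a‖, h.le, _, ⟨_, EllOne.inv_norm_smul_mem_positiveFace ha h, rfl⟩, ?_⟩
      rw [map_smul, smul_inv_smul₀ h.ne']

variable [TopologicalSpace E]

/-- The image of the positive face of `ℓ₁` under an injective linear map is a Choquet simplex as
soon as it is compact. -/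
def ChoquetSimplex.ofEllOne (κ : EllOne →ₗ[ℝ] E) (hκ : Function.Injective κ)
    (hc : IsCompact (κ '' EllOne.positiveFace)) : ChoquetSimplex E where
  carrier := κ '' EllOne.positiveFace
  nonempty := ⟨_, _, EllOne.basis_mem_positiveFace 0, rfl⟩
  isCompact := hc
  convex := EllOne.convex_positiveFace.linear_image κ
  exists_sup := by
    have hsub : ∀ a b : EllOne, ((κ a, EllOne.coordSum a) : E × ℝ) - (κ b, EllOne.coordSum b) =
        (κ (a - b), EllOne.coordSum (a - b)) := fun a b => by simp
    have hle : ∀ a b : EllOne, ((κ a, EllOne.coordSum a) : E × ℝ) - (κ b, EllOne.coordSum b) ∈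
        coneOver (κ '' EllOne.positiveFace) ↔ ∀ i, b i ≤ a i := by
      intro a b
      rw [hsub, mem_coneOver_image_positiveFace]
      constructor
      · rintro ⟨c, hc, h⟩ i
        have h1 : a - b = c := hκ (congrArg Prod.fst h)
        have h2 := hc i
        rw [← h1] at h2
        exact sub_nonneg.mp h2
      · intro h
        exact ⟨a - b, fun i => sub_nonneg.mpr (h i), rfl⟩
    intro x hx y hy
    obtain ⟨a, ha, rfl⟩ := (mem_coneOver_image_positiveFace κ x).mp hx
    obtain ⟨b, hb, rfl⟩ := (mem_coneOver_image_positiveFace κ y).mp hy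
    refine ⟨(κ (a.sup b), EllOne.coordSum (a.sup b)), ?_, ?_, ?_, ?_⟩
    · exact (mem_coneOver_image_positiveFace κ _).mpr
        ⟨_, fun i => (ha i).trans (le_max_left (a i) (b i)), rfl⟩
    · exact (hle _ _).mpr fun i => le_max_left (a i) (b i)
    · exact (hle _ _).mpr fun i => le_max_right (a i) (b i)
    · intro w hw hwa hwb
      obtain ⟨c, -, rfl⟩ := (mem_coneOver_image_positiveFace κ w).mp hw
      rw [hle] at hwa hwb ⊢
      exact fun i => max_le (hwa i) (hwb i)

/-- A continuous affine function on the simplex is determined by its values at the images of the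
basis vectors. -/
theorem apply_eq_lift_of_mem_affineFunctions {κ : EllOne →ₗ[ℝ] E} {hκ : Function.Injective κ}
    {hc : IsCompact (κ '' EllOne.positiveFace)}
    {φ : C((ChoquetSimplex.ofEllOne κ hκ hc).carrier, ℝ)}
    (hφ : φ ∈ affineFunctions (ChoquetSimplex.ofEllOne κ hκ hc)) {g : EllOne}
    (hg : g ∈ EllOne.positiveFace) :
    φ ⟨κ g, g, hg, rfl⟩ = EllOne.lift (fun k => φ ⟨κ (EllOne.basis k), _,
      EllOne.basis_mem_positiveFace k, rfl⟩) ‖φ‖ (fun _ => φ.norm_coe_le_norm _) g := by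
  classical
  let ψ : EllOne → ℝ := fun a => if h : a ∈ EllOne.positiveFace then φ ⟨κ a, a, h, rfl⟩ else 0
  have hψ : ∀ a (h : a ∈ EllOne.positiveFace), ψ a = φ ⟨κ a, a, h, rfl⟩ := fun a h => dif_pos h
  have hψn : ∀ a, |ψ a| ≤ ‖φ‖ := by
    intro a
    by_cases h : a ∈ EllOne.positiveFace
    · rw [hψ a h]; exact φ.norm_coe_le_norm _
    · simp only [ψ, dif_neg h, abs_zero]; exact norm_nonneg _
  -- This is the positively homogeneous extension of `φ` from the face to the positive cone;
  -- affinity of `φ` becomes additivity.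
  let Ψ : EllOne → ℝ := fun a => ‖a‖ * ψ (‖a‖⁻¹ • a)
  have hM : ∀ a, |Ψ a| ≤ ‖φ‖ * ‖a‖ := by
    intro a
    simp only [Ψ]
    rw [abs_mul, abs_norm, mul_comm]
    exact mul_le_mul_of_nonneg_right (hψn _) (norm_nonneg _)
  have hadd : ∀ a b : EllOne, (∀ i, 0 ≤ a i) → (∀ i, 0 ≤ b i) → Ψ (a + b) = Ψ a + Ψ b := by
    intro a b ha hb
    rcases (norm_nonneg a).eq_or_lt with h | h
    · rw [norm_eq_zero.mp h.symm]; simp [Ψ]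
    rcases (norm_nonneg b).eq_or_lt with h' | h'
    · rw [norm_eq_zero.mp h'.symm]; simp [Ψ]
    have hab : ∀ i, 0 ≤ (a + b) i := fun i => add_nonneg (ha i) (hb i)
    have hn := EllOne.norm_add_of_nonneg ha hb
    have hpos : 0 < ‖a + b‖ := by rw [hn]; positivity
    have ha' := EllOne.inv_norm_smul_mem_positiveFace ha h
    have hb' := EllOne.inv_norm_smul_mem_positiveFace hb h'
    have hab' := EllOne.inv_norm_smul_mem_positiveFace hab hpos
    have h1 := hφ ⟨_, _, ha', rfl⟩ ⟨_, _, hb', rfl⟩ ⟨_, _, hab', rfl⟩ (‖a‖ / ‖a + b‖)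
      (‖b‖ / ‖a + b‖) (by positivity) (by positivity) (by rw [← add_div, ← hn, div_self hpos.ne'])
      (by
        simp only [← map_smul, ← map_add, smul_smul, smul_add]
        rw [div_mul_eq_mul_div, div_mul_eq_mul_div, mul_inv_cancel₀ h.ne', mul_inv_cancel₀ h'.ne',
          one_div])
    simp only [Ψ]
    rw [hψ _ ha', hψ _ hb', hψ _ hab', h1]
    field_simp
  have h1 := EllOne.hasSum_of_additive hadd hM hg.1
  have h2 : Ψ g = φ ⟨κ g, g, hg, rfl⟩ := by
    simp only [Ψ]
    rw [hg.2, inv_one, one_smul, one_mul, hψ g hg]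
  have h3 : ∀ k, Ψ (g k • EllOne.basis k) =
      g k * φ ⟨κ (EllOne.basis k), _, EllOne.basis_mem_positiveFace k, rfl⟩ := by
    intro k
    have h4 : ‖g k • EllOne.basis k‖ = g k := by
      rw [norm_smul, EllOne.norm_basis, mul_one, Real.norm_of_nonneg (hg.1 k)]
    simp only [Ψ]
    rw [h4]
    rcases (hg.1 k).eq_or_lt with h | h
    · rw [← h, zero_mul, zero_mul]
    · rw [inv_smul_smul₀ h.ne', hψ _ (EllOne.basis_mem_positiveFace k)]
  rw [h2] at h1
  simp_rw [h3] at h1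
  rw [EllOne.lift_apply]
  exact tendsto_nhds_unique h1
    (EllOne.summable_smul (fun k => φ.norm_coe_le_norm _) g).hasSum.tendsto_sum_nat

end SimplexOfEllOne

/-! ### Quotient maps from approximate preimages. -/

section QuotientMap

variable {X Z : Type*} [NormedAddCommGroup X] [NormedSpace ℝ X] [NormedAddCommGroup Z]
  [NormedSpace ℝ Z]

/-- Successive approximation: approximate preimages of controlled norm yield exact ones. -/
theorem exists_preimage_of_approx [CompleteSpace X] (R : X →L[ℝ] Z) (W : Submodule ℝ Z)
    (hRW : ∀ x, R x ∈ W) {τ δ : ℝ} (hδ0 : 0 < δ) (hδ : δ < 1)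
    (h : ∀ φ ∈ W, ∃ x, ‖x‖ ≤ τ * ‖φ‖ ∧ ‖φ - R x‖ ≤ δ * ‖φ‖) {φ : Z} (hφ : φ ∈ W) :
    ∃ x, R x = φ ∧ ‖x‖ ≤ τ / (1 - δ) * ‖φ‖ := by
  have h' : ∀ ψ : W, ∃ x, ‖x‖ ≤ τ * ‖(ψ : Z)‖ ∧ ‖(ψ : Z) - R x‖ ≤ δ * ‖(ψ : Z)‖ :=
    fun ψ => h ψ ψ.2
  choose p hp1 hp2 using h'
  -- Each step replaces a target by its residual, which shrinks by the factor `δ`; the chosen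
  -- preimages sum geometrically.
  let step : W → W := fun ψ => ψ - ⟨R (p ψ), hRW _⟩
  let r : ℕ → W := fun n => step^[n] ⟨φ, hφ⟩
  have hr0 : (r 0 : Z) = φ := rfl
  have hrs : ∀ n, (r (n + 1) : Z) = r n - R (p (r n)) := by
    intro n
    simp only [r, Function.iterate_succ_apply']
    rfl
  have hrn : ∀ n, ‖(r n : Z)‖ ≤ δ ^ n * ‖φ‖ := by
    intro n
    induction n with
    | zero => rw [hr0]; simp
    | succ n ih =>
      rw [hrs, pow_succ', mul_assoc]
      exact (hp2 _).trans (mul_le_mul_of_nonneg_left ih hδ0.le)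
  rcases (norm_nonneg φ).eq_or_lt with hφ0 | hφ0
  · have : φ = 0 := norm_eq_zero.mp hφ0.symm
    exact ⟨0, by simp [this], by simp [this]⟩
  have hτ : 0 ≤ τ := by
    by_contra hneg
    push Not at hneg
    have h1 := (norm_nonneg _).trans (hp1 ⟨φ, hφ⟩)
    exact absurd h1 (not_le.mpr (mul_neg_of_neg_of_pos hneg hφ0))
  have hpn : ∀ n, ‖p (r n)‖ ≤ τ * ‖φ‖ * δ ^ n := by
    intro n
    calc _ ≤ τ * ‖(r n : Z)‖ := hp1 _
      _ ≤ τ * (δ ^ n * ‖φ‖) := mul_le_mul_of_nonneg_left (hrn n) hτ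
      _ = _ := by ring
  have hgeom := (hasSum_geometric_of_lt_one hδ0.le hδ).mul_left (τ * ‖φ‖)
  have hsum : Summable fun n => p (r n) := Summable.of_norm_bounded hgeom.summable hpn
  refine ⟨∑' n, p (r n), ?_, ?_⟩
  · have h1 : ∀ N, R (∑ n ∈ Finset.range N, p (r n)) = φ - r N := by
      intro N
      induction N with
      | zero => simp [hr0]
      | succ N ih => rw [Finset.sum_range_succ, map_add, ih, hrs]; abel
    have h2 := (R.continuous.tendsto _).comp hsum.hasSum.tendsto_sum_nat
    have h3 : Tendsto (fun N => φ - (r N : Z)) atTop (𝓝 (φ - 0)) := by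
      refine tendsto_const_nhds.sub (squeeze_zero_norm hrn ?_)
      simpa using (tendsto_pow_atTop_nhds_zero_of_lt_one hδ0.le hδ).mul_const ‖φ‖
    rw [sub_zero] at h3
    refine tendsto_nhds_unique h2 (h3.congr fun N => (h1 N).symm)
  · have h1 := tsum_of_norm_bounded hgeom hpn
    refine h1.trans (le_of_eq ?_)
    rw [div_eq_mul_inv]; ring

/-- A contraction with approximate preimages of almost the same norm induces an isometry of the
quotient by its kernel. -/
theorem exists_quotient_ker_isometryEquiv [CompleteSpace X] (R : X →L[ℝ] Z) (W : Submodule ℝ Z)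
    (hRW : ∀ x, R x ∈ W) (hR : ∀ x, ‖R x‖ ≤ ‖x‖)
    (h : ∀ φ ∈ W, ∀ τ > (1 : ℝ), ∀ δ > (0 : ℝ), ∃ x, ‖x‖ ≤ τ * ‖φ‖ ∧ ‖φ - R x‖ ≤ δ * ‖φ‖) :
    Nonempty ((X ⧸ LinearMap.ker R.toLinearMap) ≃ₗᵢ[ℝ] W) := by
  have hex : ∀ φ ∈ W, ∀ η > (0 : ℝ), ∃ x, R x = φ ∧ ‖x‖ ≤ (1 + η) * ‖φ‖ := by
    intro φ hφ η hη
    -- With `τ = 1 + δ` the exact preimage costs the factor `(1 + δ) / (1 - δ)`, which is below `1 +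
    -- η` for small `δ`.
    have hlim : Tendsto (fun δ : ℝ => (1 + δ) / (1 - δ)) (𝓝[>] 0) (𝓝 ((1 + 0) / (1 - 0))) := by
      refine Tendsto.mono_left ?_ nhdsWithin_le_nhds
      exact ((continuous_const.add continuous_id).tendsto (0 : ℝ)).div
        ((continuous_const.sub continuous_id).tendsto (0 : ℝ)) (by simp)
    have h1 : ∀ᶠ δ in 𝓝[>] (0 : ℝ), (1 + δ) / (1 - δ) < 1 + η :=
      hlim.eventually_lt_const (by simpa using hη)
    have h2 : ∀ᶠ δ in 𝓝[>] (0 : ℝ), δ < 1 := nhdsWithin_le_nhds (Iio_mem_nhds one_pos)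
    obtain ⟨δ, ⟨hδ1, hδ2⟩, hδ0⟩ := ((h1.and h2).and self_mem_nhdsWithin).exists
    have hδ0' : 0 < δ := hδ0
    obtain ⟨x, hx, hxn⟩ := exists_preimage_of_approx R W hRW (τ := 1 + δ) hδ0' hδ2
      (fun ψ hψ => h ψ hψ (1 + δ) (by linarith) δ hδ0') hφ
    exact ⟨x, hx, hxn.trans (mul_le_mul_of_nonneg_right hδ1.le (norm_nonneg _))⟩
  let RW : X →ₗ[ℝ] W := R.toLinearMap.codRestrict W hRW
  have hker : LinearMap.ker R.toLinearMap = LinearMap.ker RW := by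
    rw [LinearMap.ker_codRestrict]
  have hsurj : Function.Surjective RW := fun φ => by
    obtain ⟨x, hx, -⟩ := hex φ φ.2 1 one_pos
    exact ⟨x, Subtype.ext hx⟩
  rw [hker]
  refine ⟨{ RW.quotKerEquivOfSurjective hsurj with norm_map' := ?_ }⟩
  intro q
  obtain ⟨x, rfl⟩ := Submodule.mkQ_surjective _ q
  change ‖R x‖ = ‖(Submodule.Quotient.mk x : X ⧸ LinearMap.ker RW)‖
  refine le_antisymm ?_ ?_
  · refine le_of_forall_pos_le_add fun η hη => ?_
    obtain ⟨m, hm, hmn⟩ := Submodule.Quotient.norm_mk_lt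
      (Submodule.Quotient.mk x : X ⧸ LinearMap.ker RW) hη
    have h1 : RW m = RW x := by
      rw [← sub_eq_zero, ← map_sub]
      exact (Submodule.Quotient.eq _).mp hm
    have h2 : R m = R x := congrArg Subtype.val h1
    rw [← h2]
    exact (hR m).trans hmn.le
  · refine le_of_forall_pos_le_add fun η hη => ?_
    obtain ⟨y, hy, hyn⟩ := hex (R x) (hRW x) (η / (‖R x‖ + 1)) (by positivity)
    have h1 : (Submodule.Quotient.mk x : X ⧸ LinearMap.ker RW) = Submodule.Quotient.mk y := by
      rw [Submodule.Quotient.eq]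
      refine LinearMap.mem_ker.mpr (Subtype.ext ?_)
      change R (x - y) = 0
      rw [map_sub, hy, sub_self]
    rw [h1]
    refine (Submodule.Quotient.norm_mk_le _ y).trans (hyn.trans ?_)
    have h2 : η / (‖R x‖ + 1) * ‖R x‖ ≤ η := by
      rw [div_mul_eq_mul_div, div_le_iff₀ (by positivity)]
      nlinarith [norm_nonneg (R x)]
    linarith

end QuotientMap

/-! ### Approximation of affine functions by elements of the predual. -/

section Approximation

variable {X : Type u} [NormedAddCommGroup X] [NormedSpace ℝ X]

open scoped Pointwise in
/-- A functional of norm at most one on an isometric copy of `ℓ₁` that is weak-star continuous on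
the positive face is uniformly approximated there by elements of the predual of norm
at most `τ`. -/
theorem exists_approx_predual (Φ : StrongDual ℝ X ≃ₗᵢ[ℝ] EllOne) (J : EllOne →ₗᵢ[ℝ] EllOne)
    (A : EllOne →L[ℝ] ℝ) (hA : ∀ g, |A g| ≤ ‖g‖)
    (hc : IsCompact ((fun g => (wk Φ (J g), A g)) '' EllOne.positiveFace)) {τ : ℝ} (hτ : 1 < τ)
    {δ : ℝ} (hδ : 0 < δ) :
    ∃ x : X, ‖x‖ ≤ τ ∧ ∀ g ∈ EllOne.positiveFace, |A g - Φ.symm (J g) x| ≤ δ := by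
  obtain ⟨N, hN0, hNδ⟩ : ∃ N : ℝ, 0 < N ∧ τ / N ≤ δ := by
    refine ⟨τ / δ, by positivity, ?_⟩
    rw [div_div_cancel₀ (by positivity)]
  let L : EllOne →ₗ[ℝ] WeakDual ℝ X × ℝ :=
    ((wk Φ).toLinearMap.comp J.toLinearMap).prod A.toLinearMap
  have hL : ∀ g, L g = (wk Φ (J g), A g) := fun g => rfl
  set P : Set EllOne := {g | (∀ i, 0 ≤ g i) ∧ ‖g‖ ≤ 1} with hP
  have hPconv : Convex ℝ P := by
    rintro f ⟨hf, hf1⟩ g ⟨hg, hg1⟩ a b ha hb hab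
    refine ⟨fun i => add_nonneg (mul_nonneg ha (hf i)) (mul_nonneg hb (hg i)), ?_⟩
    have := convex_closedBall (0 : EllOne) 1 (by simpa using hf1) (by simpa using hg1) ha hb hab
    simpa using this
  have h0P : (0 : EllOne) ∈ P := ⟨fun i => le_rfl, by simp⟩
  have hFP : EllOne.positiveFace ⊆ P := fun g hg => ⟨hg.1, hg.2.le⟩
  have hLP : IsCompact (L '' P) := by
    have h1 : L '' P = (fun p : ℝ × (WeakDual ℝ X × ℝ) => p.1 • p.2) ''
        (Set.Icc (0 : ℝ) 1 ×ˢ ((fun g => (wk Φ (J g), A g)) '' EllOne.positiveFace)) := by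
      ext z
      constructor
      · rintro ⟨g, ⟨hg, hg1⟩, rfl⟩
        rcases (norm_nonneg g).eq_or_lt with h | h
        · refine ⟨(0, _), ⟨by simp, ⟨_, EllOne.basis_mem_positiveFace 0, rfl⟩⟩, ?_⟩
          rw [norm_eq_zero.mp h.symm]
          simp
        · refine ⟨(‖g‖, L (‖g‖⁻¹ • g)), ⟨⟨h.le, hg1⟩, _,
            EllOne.inv_norm_smul_mem_positiveFace hg h, rfl⟩, ?_⟩
          simp only
          rw [map_smul, smul_inv_smul₀ h.ne']
      · rintro ⟨⟨t, _⟩, ⟨ht, g, hg, rfl⟩, rfl⟩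
        refine ⟨t • g, ⟨fun i => mul_nonneg ht.1 (hg.1 i), ?_⟩, ?_⟩
        · rw [norm_smul, hg.2, mul_one, Real.norm_of_nonneg ht.1]
          exact ht.2
        · rw [map_smul]; rfl
    rw [h1]
    exact (isCompact_Icc.prod hc).image continuous_smul
  let B : Set (WeakDual ℝ X × ℝ) := (wk Φ '' Metric.closedBall (0 : EllOne) 1) ×ˢ {(0 : ℝ)}
  have hBconv : Convex ℝ B :=
    ((convex_closedBall (0 : EllOne) 1).linear_image (wk Φ).toLinearMap).prod (convex_singleton 0)
  have hBc : IsCompact B := (isCompact_wk_closedBall Φ 0 1).prod isCompact_singleton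
  let H : Set (WeakDual ℝ X × ℝ) := B + N • (L '' P - L '' P)
  have hHconv : Convex ℝ H :=
    hBconv.add (((hPconv.linear_image L).sub (hPconv.linear_image L)).smul N)
  have hHc : IsCompact H := by
    refine hBc.add (IsCompact.smul N ?_)
    rw [← Set.sub_image_prod]
    exact (hLP.prod hLP).image continuous_sub
  -- Otherwise `b + N J (p - q) = 0` with `‖b‖ ≤ 1`, so `N ‖p - q‖ ≤ 1` because `J` is isometric,
  -- while `N A (p - q) = τ > 1`.
  have hnot : ((0 : WeakDual ℝ X), τ) ∉ H := by
    rintro ⟨⟨_, r⟩, ⟨⟨b, hb, rfl⟩, hr⟩, _, ⟨_, ⟨_, ⟨p, hp, rfl⟩, _, ⟨q, hq, rfl⟩, rfl⟩, rfl⟩, h⟩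
    have hr0 : r = 0 := hr
    have h' : (wk Φ b, r) + N • (L p - L q) = ((0 : WeakDual ℝ X), τ) := h
    rw [← map_sub, hL] at h'
    have h1 : wk Φ b + N • wk Φ (J (p - q)) = 0 := congrArg Prod.fst h'
    have h2 : r + N * A (p - q) = τ := congrArg Prod.snd h'
    rw [← map_smul, ← map_add, LinearEquiv.map_eq_zero_iff] at h1
    have h3 : N * ‖p - q‖ ≤ 1 := by
      have h4 : ‖N • J (p - q)‖ = ‖b‖ := by
        rw [← neg_eq_of_add_eq_zero_right h1, norm_neg]
      rw [norm_smul, J.norm_map, Real.norm_of_nonneg hN0.le] at h4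
      rw [h4]; simpa using hb
    have h5 : N * A (p - q) ≤ N * ‖p - q‖ :=
      mul_le_mul_of_nonneg_left ((le_abs_self _).trans (hA _)) hN0.le
    linarith
  have : LocallyConvexSpace ℝ (WeakDual ℝ X) := (WeakDual.withSeminorms ℝ X).toLocallyConvexSpace
  obtain ⟨f, c, hf, hcτ⟩ := geometric_hahn_banach_closed_point hHconv hHc.isClosed hnot
  have hmem : ∀ b ∈ Metric.closedBall (0 : EllOne) 1, ∀ p ∈ P, ∀ q ∈ P,
      f (wk Φ b, 0) + N * f (L (p - q)) < c := by
    intro b hb p hp q hq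
    have h1 := hf ((wk Φ b, 0) + N • (L p - L q))
      (Set.add_mem_add ⟨⟨b, hb, rfl⟩, rfl⟩
        (Set.smul_mem_smul_set (Set.sub_mem_sub ⟨p, hp, rfl⟩ ⟨q, hq, rfl⟩)))
    rwa [map_add, map_smul, ← map_sub, smul_eq_mul] at h1
  -- Weak-star continuous functionals are evaluations, so the separating functional is `(z, t) ↦ z
  -- x' + t * s`.
  obtain ⟨x', hx'⟩ := LinearMap.dualEmbedding_surjective (topDualPairing ℝ X)
    (f.comp (ContinuousLinearMap.inl ℝ (WeakDual ℝ X) ℝ))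
  have hx : ∀ z : WeakDual ℝ X, f (z, 0) = z x' := fun z =>
    (congrArg (fun F : StrongDual ℝ (WeakDual ℝ X) => F z) hx').symm
  set s := f ((0 : WeakDual ℝ X), (1 : ℝ)) with hs
  have hsplit : ∀ (z : WeakDual ℝ X) (t : ℝ), f (z, t) = z x' + t * s := by
    intro z t
    rw [← hx, hs, ← smul_eq_mul, ← map_smul, ← map_add]
    simp
  have h0x : (0 : WeakDual ℝ X) x' = 0 := rfl
  have hcpos : 0 < c := by
    have := hmem 0 (by simp) 0 h0P 0 h0P
    rw [hx] at this
    simpa [h0x] using this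
  rw [hsplit] at hcτ
  have hcτ' : c < τ * s := by rwa [h0x, zero_add] at hcτ
  have hspos : 0 < s := by
    by_contra hneg
    push Not at hneg
    nlinarith
  -- Testing on the ball gives `‖x'‖ ≤ c < τ * s`. Testing on `± N L g` bounds `|Φ.symm (J g) x' + A
  -- g * s|` by `τ * s / N`. Dividing by `s` yields both claims.
  refine ⟨-s⁻¹ • x', ?_, ?_⟩
  · obtain ⟨G, hG, hGx⟩ := exists_dual_vector'' ℝ x'
    have h1 := hmem (Φ G) (by simpa using hG) 0 h0P 0 h0P
    rw [hsplit, wk_apply, Φ.symm_apply_apply, hGx] at h1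
    simp only [sub_self, map_zero, mul_zero, zero_mul, add_zero, RCLike.ofReal_real_eq_id,
      id_eq] at h1
    rw [norm_smul, norm_neg, norm_inv, Real.norm_of_nonneg hspos.le, inv_mul_le_iff₀ hspos]
    linarith
  · intro g hg
    have h1 := hmem 0 (by simp) g (hFP hg) 0 h0P
    have h2 := hmem 0 (by simp) 0 h0P g (hFP hg)
    simp only [hL, hsplit, map_zero, sub_zero, zero_sub, map_neg, wk_apply] at h1 h2
    set e := Φ.symm (J g) x' with he
    have h1' : N * (e + A g * s) < τ * s := by
      rw [h0x] at h1
      linarith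
    have h2' : -(N * (e + A g * s)) < τ * s := by
      have h4 : (-wk Φ (J g)) x' = -e := rfl
      rw [h0x, h4] at h2
      linarith
    refine le_trans ?_ hNδ
    have h3 : A g - Φ.symm (J g) (-s⁻¹ • x') = (e + A g * s) / s := by
      rw [map_smul, smul_eq_mul, ← he]
      field_simp
      ring
    rw [h3, abs_div, abs_of_pos hspos, div_le_div_iff₀ hspos hN0]
    rcases abs_cases (e + A g * s) with h4 | h4 <;> rw [h4.1] <;> linarith

end Approximation

/-! ### The quotient isometric to `A(S)`. -/

section QuotientSimplex

variable {X : Type u} [NormedAddCommGroup X] [NormedSpace ℝ X]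

/-- Evaluation of weak-star functionals along a dense sequence. -/
noncomputable def evalSeq (d : ℕ → X) : WeakDual ℝ X →L[ℝ] (ULift.{v} ℕ → ℝ) :=
  ContinuousLinearMap.pi fun n =>
    { toFun := fun z => z (d n.down)
      map_add' := fun _ _ => rfl
      map_smul' := fun _ _ => rfl
      cont := WeakDual.eval_continuous _ }

theorem evalSeq_injective {d : ℕ → X} (hd : DenseRange d) :
    Function.Injective (evalSeq.{u, v} d) := by
  intro z w h
  refine DFunLike.ext' (hd.equalizer (map_continuous z) (map_continuous w) ?_)
  funext n
  exact congrFun h ⟨n⟩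

/-- An isometric copy of `ℓ₁` whose basis converges weak-star to a positive norm-one combination of
itself yields a quotient of the predual that is isometric to some `A(S)`. -/
theorem exists_quotient_isometric_affineFunctions [CompleteSpace X]
    (Φ : StrongDual ℝ X ≃ₗᵢ[ℝ] EllOne)
    (J : EllOne →ₗᵢ[ℝ] EllOne) {α : EllOne} (hα : α ∈ EllOne.positiveFace)
    (hlim : Tendsto (fun k => wk Φ (J (EllOne.basis k))) atTop (𝓝 (wk Φ (J α)))) :
    ∃ Y : Submodule ℝ X, IsClosed (Y : Set X) ∧ ∃ S : ChoquetSimplex (ULift.{v} ℕ → ℝ),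
      ¬ FiniteDimensional ℝ (affineFunctions S) ∧
      Nonempty ((X ⧸ Y) ≃ₗᵢ[ℝ] affineFunctions S) := by
  have hsepX := separableSpace_of_dual_equiv Φ
  set C : Set (WeakDual ℝ X) := (fun g => wk Φ (J g)) '' EllOne.positiveFace with hC
  have hCc : IsCompact C := isCompact_wk_image_positiveFace Φ J hα hlim
  -- Evaluation on a dense sequence places the simplex in a product of lines; `ULift` lets it live
  -- in any prescribed universe.
  let ev : WeakDual ℝ X →L[ℝ] (ULift.{v} ℕ → ℝ) := evalSeq (denseSeq X)
  have hev : Function.Injective ev := evalSeq_injective (denseRange_denseSeq X)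
  let κ : EllOne →ₗ[ℝ] (ULift.{v} ℕ → ℝ) :=
    ev.toLinearMap.comp ((wk Φ).toLinearMap.comp J.toLinearMap)
  have hκ : Function.Injective κ := hev.comp ((wk Φ).injective.comp J.injective)
  have hκc : IsCompact (κ '' EllOne.positiveFace) := by
    have h1 : κ '' EllOne.positiveFace = ev '' C := by rw [hC, Set.image_image]; rfl
    rw [h1]
    exact hCc.image ev.continuous
  set S := ChoquetSimplex.ofEllOne κ hκ hκc with hS
  -- the inverse of the evaluation map on the compact set `C`
  obtain ⟨θ, hθc, hθ⟩ : ∃ θ : S.carrier → WeakDual ℝ X, Continuous θ ∧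
      ∀ g (hg : g ∈ EllOne.positiveFace), θ ⟨κ g, g, hg, rfl⟩ = wk Φ (J g) := by
    have : CompactSpace C := isCompact_iff_compactSpace.mp hCc
    let e : C → S.carrier := fun z => ⟨ev z, by
      obtain ⟨g, hg, h⟩ := z.2
      exact ⟨g, hg, congrArg ev h⟩⟩
    have hec : Continuous e := (ev.continuous.comp continuous_subtype_val).subtype_mk _
    have heb : Function.Bijective e := by
      constructor
      · intro z w h
        exact Subtype.ext (hev (congrArg Subtype.val h))
      · rintro ⟨_, g, hg, rfl⟩
        exact ⟨⟨_, g, hg, rfl⟩, rfl⟩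
    let E := Equiv.ofBijective e heb
    have hEc : Continuous E.symm := (Continuous.homeoOfEquivCompactToT2 (f := E) hec).symm.continuous
    refine ⟨fun p => E.symm p, continuous_subtype_val.comp hEc, fun g hg => ?_⟩
    have h1 : E.symm ⟨κ g, g, hg, rfl⟩ = ⟨wk Φ (J g), g, hg, rfl⟩ := by
      rw [Equiv.symm_apply_eq]; rfl
    exact congrArg Subtype.val h1
  have hθn : ∀ p x, |θ p x| ≤ ‖x‖ := by
    rintro ⟨_, g, hg, rfl⟩ x
    rw [hθ g hg]
    have := abs_symm_apply_le Φ (J g) x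
    rwa [J.norm_map, hg.2, one_mul] at this
  let R : X →L[ℝ] C(S.carrier, ℝ) := LinearMap.mkContinuous
    { toFun := fun x => ⟨fun p => θ p x, (WeakDual.eval_continuous x).comp hθc⟩
      map_add' := fun x y => ContinuousMap.ext fun p => map_add (θ p) x y
      map_smul' := fun c x => ContinuousMap.ext fun p => map_smul (θ p) c x } 1 fun x => by
      rw [one_mul]
      exact (ContinuousMap.norm_le _ (norm_nonneg x)).mpr fun p => hθn p x
  have hR : ∀ x p, R x p = θ p x := fun _ _ => rfl
  have hRn : ∀ x, ‖R x‖ ≤ ‖x‖ := fun x =>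
    (ContinuousMap.norm_le _ (norm_nonneg x)).mpr fun p => hθn p x
  have hRW : ∀ x, R x ∈ affineFunctions S := by
    rintro x ⟨_, f, hf, rfl⟩ ⟨_, g, hg, rfl⟩ ⟨_, h, hh, rfl⟩ a b ha hb hab hz
    have h1 : h = a • f + b • g := hκ (by rw [map_add, map_smul, map_smul]; exact hz)
    rw [hR, hR, hR, hθ f hf, hθ g hg, hθ h hh, h1, map_add, map_smul, map_smul, map_add, map_smul,
      map_smul]
    rfl
  have happrox : ∀ φ ∈ affineFunctions S, ∀ τ > (1 : ℝ), ∀ δ > (0 : ℝ),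
      ∃ x, ‖x‖ ≤ τ * ‖φ‖ ∧ ‖φ - R x‖ ≤ δ * ‖φ‖ := by
    intro φ hφ τ hτ δ hδ
    rcases (norm_nonneg φ).eq_or_lt with h0 | h0
    · have : φ = 0 := norm_eq_zero.mp h0.symm
      exact ⟨0, by simp [this], by simp [this]⟩
    let h : ℕ → ℝ := fun k => φ ⟨κ (EllOne.basis k), _, EllOne.basis_mem_positiveFace k, rfl⟩
    -- Normalizing by `‖φ‖` makes the functional a contraction, as `exists_approx_predual` requires.
    let A : EllOne →L[ℝ] ℝ := ‖φ‖⁻¹ • EllOne.lift h ‖φ‖ fun _ => φ.norm_coe_le_norm _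
    have hAφ : ∀ g (hg : g ∈ EllOne.positiveFace), A g = ‖φ‖⁻¹ * φ ⟨κ g, g, hg, rfl⟩ := by
      intro g hg
      rw [apply_eq_lift_of_mem_affineFunctions hφ hg]; rfl
    have hA : ∀ g, |A g| ≤ ‖g‖ := by
      intro g
      have h1 := (EllOne.lift h ‖φ‖ fun _ => φ.norm_coe_le_norm _).le_of_opNorm_le
        (LinearMap.mkContinuous_norm_le _ (norm_nonneg φ) _) g
      have h2 : A g = ‖φ‖⁻¹ • EllOne.lift h ‖φ‖ (fun _ => φ.norm_coe_le_norm _) g := rfl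
      rw [← Real.norm_eq_abs, h2, norm_smul, norm_inv, norm_norm, inv_mul_le_iff₀ h0]
      exact h1
    have hc : IsCompact ((fun g => (wk Φ (J g), A g)) '' EllOne.positiveFace) := by
      have h1 : (fun g => (wk Φ (J g), A g)) '' EllOne.positiveFace =
          Set.range fun p : S.carrier => (θ p, ‖φ‖⁻¹ * φ p) := by
        ext z
        constructor
        · rintro ⟨g, hg, rfl⟩
          exact ⟨⟨κ g, g, hg, rfl⟩, Prod.ext (hθ g hg) (hAφ g hg).symm⟩
        · rintro ⟨⟨_, g, hg, rfl⟩, rfl⟩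
          exact ⟨g, hg, (Prod.ext (hθ g hg) (hAφ g hg).symm).symm⟩
      rw [h1]
      exact isCompact_range (hθc.prodMk (continuous_const.mul φ.continuous))
    obtain ⟨x, hx, hx'⟩ := exists_approx_predual Φ J A hA hc hτ hδ
    refine ⟨‖φ‖ • x, ?_, ?_⟩
    · rw [norm_smul, norm_norm, mul_comm]
      exact mul_le_mul_of_nonneg_right hx h0.le
    · refine (ContinuousMap.norm_le _ (by positivity)).mpr ?_
      rintro ⟨_, g, hg, rfl⟩
      have h1 := hx' g hg
      rw [hAφ g hg] at h1
      rw [ContinuousMap.sub_apply, hR, hθ g hg, wk_apply, map_smul, smul_eq_mul, Real.norm_eq_abs]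
      have h2 : φ ⟨κ g, g, hg, rfl⟩ - ‖φ‖ * Φ.symm (J g) x =
          ‖φ‖ * (‖φ‖⁻¹ * φ ⟨κ g, g, hg, rfl⟩ - Φ.symm (J g) x) := by
        rw [mul_sub, mul_inv_cancel_left₀ h0.ne']
      rw [h2, abs_mul, abs_norm, mul_comm]
      exact mul_le_mul_of_nonneg_right h1 h0.le
  refine ⟨LinearMap.ker R.toLinearMap, R.isClosed_ker, S, ?_,
    exists_quotient_ker_isometryEquiv R (affineFunctions S) hRW hRn happrox⟩
  intro hfin
  -- evaluations at the images of the basis vectors are linearly independent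
  let b : ℕ → Module.Dual ℝ (affineFunctions S) := fun k =>
    { toFun := fun φ => (φ : C(S.carrier, ℝ))
        ⟨κ (EllOne.basis k), _, EllOne.basis_mem_positiveFace k, rfl⟩
      map_add' := fun _ _ => rfl
      map_smul' := fun _ _ => rfl }
  have hb : LinearIndependent ℝ b := by
    rw [linearIndependent_iff']
    intro s c hc i hi
    have h1 : ∑ k ∈ s, c k • EllOne.basis k = 0 := by
      apply J.injective
      apply (wk Φ).injective
      refine DFunLike.ext _ _ fun x => ?_
      have h2 := LinearMap.congr_fun hc ⟨R x, hRW x⟩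
      rw [map_zero, map_zero, wk_apply, ← evalAt_apply, map_sum, map_sum]
      rw [LinearMap.sum_apply] at h2
      refine Eq.trans (Finset.sum_congr rfl fun k _ => ?_) h2
      rw [map_smul, map_smul, evalAt_apply, LinearMap.smul_apply]
      change _ = c k • R x ⟨κ (EllOne.basis k), _, EllOne.basis_mem_positiveFace k, rfl⟩
      rw [hR, hθ _ (EllOne.basis_mem_positiveFace k)]
      rfl
    have h2 := congrArg (fun g : EllOne => g i) h1
    simp only [lp.coeFn_sum, Finset.sum_apply] at h2
    have h3 : ∀ k, (c k • EllOne.basis k) i = if i = k then c k else 0 := by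
      intro k
      change c k * EllOne.basis k i = _
      rw [EllOne.basis_apply]; split_ifs <;> simp
    simp_rw [h3] at h2
    rw [Finset.sum_ite_eq, if_pos hi] at h2
    exact h2
  have : Finite ℕ := hb.finite
  exact not_finite ℕ

end QuotientSimplex

/-! ### The equivalence. -/

theorem mainTheorem3 {X : Type u} [NormedAddCommGroup X] [NormedSpace ℝ X] [CompleteSpace X]
    (Φ : StrongDual ℝ X ≃ₗᵢ[ℝ] EllOne) :
    List.TFAE [
      ¬ HasFPP EllOne (sigmaTopology Φ),
      ∃ Y : Submodule ℝ X, IsClosed (Y : Set X) ∧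
        ∃ (E : Type v) (_ : AddCommGroup E) (_ : Module ℝ E) (_ : TopologicalSpace E)
          (_ : IsTopologicalAddGroup E) (_ : ContinuousSMul ℝ E) (_ : LocallyConvexSpace ℝ E)
          (_ : T2Space E) (S : ChoquetSimplex E),
          ¬ FiniteDimensional ℝ (affineFunctions S) ∧
          Nonempty ((X ⧸ Y) ≃ₗᵢ[ℝ] affineFunctions S),
      ∃ Y : Submodule ℝ X, IsClosed (Y : Set X) ∧
        ∃ (E : Type v) (_ : AddCommGroup E) (_ : Module ℝ E) (_ : TopologicalSpace E)
          (_ : IsTopologicalAddGroup E) (_ : ContinuousSMul ℝ E) (_ : LocallyConvexSpace ℝ E)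
          (_ : T2Space E) (S : ChoquetSimplex E),
          ¬ FiniteDimensional ℝ (affineFunctions S) ∧
          Nonempty (affineFunctions S →ₗᵢ[ℝ] (X ⧸ Y))] := by
  -- This passage from `D` to `J` serves both `1 → 2` and `3 → 1`.
  have key : ∀ D : Set EllOne, Convex ℝ D → IsCompact (wk Φ '' D) → (∀ g ∈ D, ‖g‖ = 1) →
      ¬ IsCompact D → ∃ (J : EllOne →ₗᵢ[ℝ] EllOne) (α : EllOne), α ∈ EllOne.positiveFace ∧
        Tendsto (fun k => wk Φ (J (EllOne.basis k))) atTop (𝓝 (wk Φ (J α))) := by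
    intro D h1 h2 h3 h4
    obtain ⟨ε, hε, f, hf, hεf, n, hn, hlim⟩ := exists_basis_subseq_tendsto Φ h1 h2 h3 h4
    obtain ⟨J, α, hα, hα1, hJ⟩ := exists_isometry_of_basis_subseq Φ hε hf hεf hn hlim
    exact ⟨J, α, ⟨hα, hα1⟩, hJ⟩
  tfae_have 1 → 2 := by
    intro h
    obtain ⟨D, h1, h2, h3, h4⟩ := exists_noncompact_convex_of_not_hasFPP Φ h
    obtain ⟨J, α, hα, hJ⟩ := key D h1 h2 h3 h4
    obtain ⟨Y, hY, S, hS, e⟩ := exists_quotient_isometric_affineFunctions.{u, v} Φ J hα hJ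
    exact ⟨Y, hY, _, _, _, _, inferInstance, inferInstance, inferInstance, inferInstance, S, hS, e⟩
  tfae_have 2 → 3 := by
    rintro ⟨Y, hY, E, i1, i2, i3, i4, i5, i6, i7, S, hS, ⟨e⟩⟩
    exact ⟨Y, hY, E, i1, i2, i3, i4, i5, i6, i7, S, hS, ⟨e.symm.toLinearIsometry⟩⟩
  tfae_have 3 → 1 := by
    rintro ⟨Y, hY, E, i1, i2, i3, i4, i5, i6, i7, S, hS, ⟨ι⟩⟩
    obtain ⟨D, h1, h2, h3, h4⟩ := exists_noncompact_convex_of_simplex Φ Y S hS ι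
    obtain ⟨J, α, hα, hJ⟩ := key D h1 h2 h3 h4
    exact not_hasFPP_of_isometry Φ J hα hJ
  tfae_finish
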